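/- For $n\ge 0$ let $\widetilde S_n$ be the group generated by $z,t_1,\dots,t_{n-1}$ subject to: $z$ is central, $z^2=1$, $t_i^2=z$, $t_it_{i+1}t_i=t_{i+1}t_it_{i+1}$, and $t_jt_i=z\,t_it_j$ for $|i-j|>1$; it is regarded as a subgroup of $\widetilde S_{n+1}$ via $z\mapsto z$, $t_i\mapsto t_i$. Put $x_i=t_it_{i+1}\cdots t_{n-1}t_nt_{n-1}\cdots t_{i+1}t_i\in\widetilde S_{n+1}$ for $1\le i\le n$, and for distinct $i_1,\dots,i_m\in\{1,\dots,n\}$ let $[i_1,\dots,i_m]=x_{i_1}x_{i_m}x_{i_{m-1}}\cdots x_{i_2}x_{i_1}\in\widetilde S_n$ if $m>1$, and $[i_1]=z$. Let $\mathcal{EP}$ be the set of all partitions (of all sizes, including the empty one) all of whose parts are even. For $\lambda=(\lambda_1\ge\dots\ge\lambda_\ell)\in\mathcal{EP}$, of size $|\lambda|$ and length $\ell(\lambda)=\ell$, let $D_\lambda(n)$ be the conjugacy class in $\widetilde S_n$ of $$t_\lambda=[1,\dots,\lambda_1+1]\,[\lambda_1+2,\dots,\lambda_1+\lambda_2+2]\cdots[\lambda_1+\dots+\lambda_{\ell-1}+\ell,\dots,\lambda_1+\dots+\lambda_\ell+\ell]$$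 if $|\lambda|+\ell(\lambda)\le n$, and $D_\lambda(n)=\emptyset$ otherwise. Let $\mathbb ZS_n^-=\mathbb Z\widetilde S_n/\langle z+1\rangle$, a superalgebra with all $t_i$ odd, let $\mathcal Z(\mathbb ZS_n^-)$ be its even center (the ring of its even central elements), and let $d_\lambda(n)$ be the image in $\mathbb ZS_n^-$ of the class sum of $D_\lambda(n)$ (so $d_\lambda(n)=0$ if $|\lambda|+\ell(\lambda)>n$). Let $\mathbb B$ be the ring of all polynomials $p\in\mathbb Q[x]$ with $p(k)\in\mathbb Z$ for all $k\in\mathbb Z$. **Proposition.** (a) For all $n\ge0$ and $\lambda,\mu\in\mathcal{EP}$ there are unique integers $a_{\lambda\mu}^\nu(n)$, for $\nu\in\mathcal{EP}$ with $|\nu|+\ell(\nu)\le n$, such that $$d_\lambda(n)\,d_\mu(n)=\sum_{\nu}a_{\lambda\mu}^\nu(n)\,d_\nu(n),$$ and for all $\lambda,\mu,\nu\in\mathcal{EP}$ there is a unique $f_{\lambda\mu}^\nu\in\mathbb B$ with $f_{\lambda\mu}^\nu(n)=a_{\lambda\mu}^\nu(n)$ for all $n\ge|\nu|+\ell(\nu)$.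 Let the (filtered) spin FH-algebra $\mathcal K$ be the free $\mathbb B$-module with basis $\{d_\lambda\mid\lambda\in\mathcal{EP}\}$, with the $\mathbb B$-bilinear multiplication given by $$d_\lambda d_\mu=\sum_{\nu\in\mathcal{EP},\ |\nu|\le|\lambda|+|\mu|}f_{\lambda\mu}^\nu\,d_\nu .$$ (b) $\mathcal K$ is associative and commutative, with unit $d_\emptyset$. (c) For every $n\ge0$ the map $$\phi_n:\mathcal K\to\mathcal Z(\mathbb ZS_n^-),\qquad \sum_\lambda f_\lambda(x)\,d_\lambda\mapsto\sum_\lambda f_\lambda(n)\,d_\lambda(n)$$ is a surjective (unital) ring homomorphism. -/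

import Mathlib

noncomputable section

namespace SpinSym

/-! ### The double cover of the symmetric group -/

/-- The generators `z, t_1, …, t_{n-1}` of the double cover of `S_n`. -/
inductive Gen (n : ℕ) : Type
  | z : Gen n
  | t (i : ℕ) (h₁ : 1 ≤ i) (h₂ : i < n) : Gen n

/-- The defining relators of the double cover of `S_n`. -/
inductive Relator (n : ℕ) : FreeGroup (Gen n) → Prop
  | z_central (i : ℕ) (h₁ : 1 ≤ i) (h₂ : i < n) :
      Relator n (.of .z * .of (.t i h₁ h₂) * (.of (.t i h₁ h₂) * .of .z)⁻¹)
  | z_sq : Relator n (.of .z ^ 2)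
  | t_sq (i : ℕ) (h₁ : 1 ≤ i) (h₂ : i < n) :
      Relator n (.of (.t i h₁ h₂) ^ 2 * (.of .z)⁻¹)
  | braid (i : ℕ) (h₁ : 1 ≤ i) (h₂ : i < n) (k₁ : 1 ≤ i + 1) (k₂ : i + 1 < n) :
      Relator n (.of (.t i h₁ h₂) * .of (.t (i + 1) k₁ k₂) * .of (.t i h₁ h₂) *
        (.of (.t (i + 1) k₁ k₂) * .of (.t i h₁ h₂) * .of (.t (i + 1) k₁ k₂))⁻¹)
  | far (i j : ℕ) (h₁ : 1 ≤ i) (h₂ : i < n) (k₁ : 1 ≤ j) (k₂ : j < n)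
      (hij : i + 1 < j ∨ j + 1 < i) :
      Relator n (.of (.t j k₁ k₂) * .of (.t i h₁ h₂) *
        (.of .z * .of (.t i h₁ h₂) * .of (.t j k₁ k₂))⁻¹)

/-- The double cover of `S_n`: generators `z, t_1, …, t_{n-1}`; relations `z` central, `z² = 1`,
`t_i² = z`, `t_i t_{i+1} t_i = t_{i+1} t_i t_{i+1}`, `t_j t_i = z t_i t_j` for `|i - j| > 1`. -/
abbrev Cover (n : ℕ) : Type := PresentedGroup {r : FreeGroup (Gen n) | Relator n r}

/-- The central element `z`. -/
def z (n : ℕ) : Cover n := PresentedGroup.of .z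

/-- The generator `t_i`, for `1 ≤ i < n` (and, by convention, `1` for other indices `i`, which
are never used). -/
def t (n i : ℕ) : Cover n :=
  if h : 1 ≤ i ∧ i < n then PresentedGroup.of (.t i h.1 h.2) else 1

/-- The natural homomorphism from the cover of `S_n` to the cover of `S_{n+1}`,
`z ↦ z`, `t_i ↦ t_i`. -/
def incl (n : ℕ) : Cover n →* Cover (n + 1) :=
  PresentedGroup.toGroup
    (f := fun g : Gen n => match g with
      | .z => PresentedGroup.of .z
      | .t i h₁ h₂ => PresentedGroup.of (.t i h₁ (Nat.lt_succ_of_lt h₂)))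
    (by
      intro r hr
      have key : ∀ s, Relator (n + 1) s →
          (PresentedGroup.mk {r : FreeGroup (Gen (n + 1)) | Relator (n + 1) r}) s = 1 :=
        fun s hs => PresentedGroup.one_of_mem hs
      cases hr with
      | z_central i h₁ h₂ => simpa [PresentedGroup.of] using key _ (.z_central i h₁ (by omega))
      | z_sq => simpa [PresentedGroup.of] using key _ .z_sq
      | t_sq i h₁ h₂ => simpa [PresentedGroup.of] using key _ (.t_sq i h₁ (by omega))
      | braid i h₁ h₂ k₁ k₂ =>
        simpa [PresentedGroup.of] using key _ (.braid i h₁ (by omega) k₁ (by omega))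
      | far i j h₁ h₂ k₁ k₂ hij =>
        simpa [PresentedGroup.of] using key _ (.far i j h₁ (by omega) k₁ (by omega) hij))

/-- The `ℤ/2`-degree: `t_i` is odd and `z` is even. -/
def parity (n : ℕ) : Cover n →* Multiplicative (ZMod 2) :=
  PresentedGroup.toGroup
    (f := fun g : Gen n => match g with
      | .z => 1
      | .t _ _ _ => Multiplicative.ofAdd 1)
    (by
      intro r hr
      cases hr <;> simp
      decide)

/-- `x_i = t_i t_{i+1} ⋯ t_{n-1} t_n t_{n-1} ⋯ t_{i+1} t_i` in the cover of `S_{n+1}`,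
a lift of the transposition `(i, n+1)`, for `1 ≤ i ≤ n`. -/
def x (n i : ℕ) : Cover (n + 1) :=
  ((List.range' i (n - i)).map (t (n + 1))).prod * t (n + 1) n *
    ((List.range' i (n - i)).reverse.map (t (n + 1))).prod

/-- The cycle `[i_1, …, i_m]` of distinct elements of `{1, …, n}`: it is `z` for `m = 1` and
`x_{i_1} x_{i_m} x_{i_{m-1}} ⋯ x_{i_2} x_{i_1}` for `m > 1`. It is an element of the cover of
`S_{n+1}` (which lies in the image of the cover of `S_n`). -/
def cycle (n : ℕ) : List ℕ → Cover (n + 1)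
  | [] => 1
  | [_] => z (n + 1)
  | i :: is => x n i * (is.reverse.map (x n)).prod * x n i

/-- The product `[o+1, …, o+λ_1+1] [o+λ_1+2, …, o+λ_1+λ_2+2] ⋯` of cycles on consecutive
intervals. -/
def blockCycles (n : ℕ) : ℕ → List ℕ → Cover (n + 1)
  | _, [] => 1
  | o, l :: ls => cycle n (List.range' (o + 1) (l + 1)) * blockCycles n (o + l + 1) ls

/-! ### Even partitions and even split classes -/

/-- Partitions (of arbitrary size) all of whose parts are even. -/
abbrev EvenPartition : Type := Σ m : ℕ, {p : Nat.Partition m // ∀ i ∈ p.parts, Even i}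

namespace EvenPartition

/-- The parts of a partition, in non-increasing order. -/
def parts (la : EvenPartition) : List ℕ := la.2.1.parts.sort (· ≥ ·)

/-- The size `|λ|`. -/
def size (la : EvenPartition) : ℕ := la.1

/-- The number `ℓ(λ)` of parts. -/
def length (la : EvenPartition) : ℕ := la.2.1.parts.card

/-- The empty partition. -/
def empty : EvenPartition := ⟨0, default, by simp⟩

/-- The even partitions with `|λ| ≤ m`. -/
def sizeLE (m : ℕ) : Finset EvenPartition :=
  (Finset.range (m + 1)).sigma fun _ => Finset.univ

theorem mem_sizeLE {m : ℕ} {la : EvenPartition} : la ∈ sizeLE m ↔ la.size ≤ m := by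
  simp [sizeLE, size]

/-- The even partitions with `|λ| + ℓ(λ) ≤ n`. -/
def fits (n : ℕ) : Finset EvenPartition :=
  (sizeLE n).filter fun la => la.size + la.length ≤ n

theorem mem_fits {n : ℕ} {la : EvenPartition} :
    la ∈ fits n ↔ la.size + la.length ≤ n := by
  simp only [fits, Finset.mem_filter, mem_sizeLE]
  omega

end EvenPartition

/-- The distinguished element
`t_λ = [1, …, λ_1+1] [λ_1+2, …, λ_1+λ_2+2] ⋯` of modified cycle type `λ`. -/
def tPart (n : ℕ) (la : EvenPartition) : Cover (n + 1) := blockCycles n 0 la.parts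

/-- The even split class `D_λ(n)`: the conjugacy class of `t_λ` in the cover of `S_n` if
`|λ| + ℓ(λ) ≤ n`, and the empty set otherwise. -/
def D (n : ℕ) (la : EvenPartition) : Set (Cover n) :=
  {g | la.size + la.length ≤ n ∧ ∃ h : Cover n, incl n h = tPart n la ∧ IsConj h g}

/-! ### The spin group algebra and its even center -/

/-- The spin group algebra `ℤS_n⁻`: the group ring of the cover modulo the two-sided ideal
generated by `z + 1`. -/
def SpinAlg (n : ℕ) : Type :=
  RingQuot fun a b : MonoidAlgebra ℤ (Cover n) => a = MonoidAlgebra.of ℤ (Cover n) (z n) + 1 ∧ b = 0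

instance (n : ℕ) : Ring (SpinAlg n) :=
  inferInstanceAs (Ring (RingQuot fun a b : MonoidAlgebra ℤ (Cover n) =>
    a = MonoidAlgebra.of ℤ (Cover n) (z n) + 1 ∧ b = 0))

/-- The quotient map from the group ring of the cover to the spin group algebra. -/
def quotMap (n : ℕ) : MonoidAlgebra ℤ (Cover n) →+* SpinAlg n :=
  RingQuot.mkRingHom fun a b : MonoidAlgebra ℤ (Cover n) =>
    a = MonoidAlgebra.of ℤ (Cover n) (z n) + 1 ∧ b = 0

/-- The image of a group element in the spin group algebra. -/
def toSpin (n : ℕ) : Cover n →* SpinAlg n :=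
  (quotMap n : MonoidAlgebra ℤ (Cover n) →* SpinAlg n).comp (MonoidAlgebra.of ℤ (Cover n))

/-- The even part of the superalgebra `ℤS_n⁻`: the span of the images of the even group
elements. -/
def evenPart (n : ℕ) : Subalgebra ℤ (SpinAlg n) :=
  (Submodule.span ℤ (toSpin n '' {g | parity n g = 1})).toSubalgebra
    (Submodule.subset_span ⟨1, by simp, by simp⟩)
    (by
      intro a b ha hb
      have h := Submodule.mul_mem_mul ha hb
      rw [Submodule.span_mul_span] at h
      refine Submodule.span_mono ?_ h
      rintro _ ⟨_, ⟨g, hg, rfl⟩, _, ⟨k, hk, rfl⟩, rfl⟩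
      exact ⟨g * k, by simp_all, by simp⟩)

/-- The even center `𝒵(ℤS_n⁻)`: the even elements that commute with everything. -/
def evenCenter (n : ℕ) : Subalgebra ℤ (SpinAlg n) :=
  Subalgebra.center ℤ (SpinAlg n) ⊓ evenPart n

/-- `d_λ(n)`: the image in `ℤS_n⁻` of the class sum of `D_λ(n)` (the cover is a finite group, so
the sum is finite); it is `0` if `|λ| + ℓ(λ) > n`. -/
def dn (n : ℕ) (la : EvenPartition) : SpinAlg n :=
  quotMap n (∑ᶠ g ∈ D n la, MonoidAlgebra.of ℤ (Cover n) g)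

/-! ### Structure constants -/

/-- `a ν` (for `|ν| + ℓ(ν) ≤ n`) are the coefficients in
`d_λ(n) d_μ(n) = ∑_ν a_{λμ}^ν(n) d_ν(n)`; they are set to `0` where they are undetermined. -/
def IsStructureConstants (n : ℕ) (la mu : EvenPartition) (a : EvenPartition → ℤ) : Prop :=
  (∀ nu : EvenPartition, n < nu.size + nu.length → a nu = 0) ∧
    dn n la * dn n mu = ∑ nu ∈ EvenPartition.fits n, a nu • dn n nu

/-- The structure constants `a_{λμ}^ν(n)`. -/
def structConst (n : ℕ) (la mu : EvenPartition) : EvenPartition → ℤ :=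
  Classical.epsilon (IsStructureConstants n la mu)

/-- The ring `𝔹` of (rational) polynomials that take integer values at all integers. -/
def IntValued : Subring (Polynomial ℚ) where
  carrier := {p | ∀ k : ℤ, ∃ m : ℤ, p.eval (k : ℚ) = m}
  mul_mem' := by
    intro p q hp hq k
    obtain ⟨a, ha⟩ := hp k
    obtain ⟨b, hb⟩ := hq k
    exact ⟨a * b, by simp [ha, hb]⟩
  one_mem' := fun _ => ⟨1, by simp⟩
  add_mem' := by
    intro p q hp hq k
    obtain ⟨a, ha⟩ := hp k
    obtain ⟨b, hb⟩ := hq k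
    exact ⟨a + b, by simp [ha, hb]⟩
  zero_mem' := fun _ => ⟨0, by simp⟩
  neg_mem' := by
    intro p hp k
    obtain ⟨a, ha⟩ := hp k
    exact ⟨-a, by simp [ha]⟩

/-- The integer value at `k` of an integer-valued polynomial. -/
def evalInt (k : ℤ) (p : IntValued) : ℤ := Classical.choose (p.2 k)

theorem evalInt_spec (k : ℤ) (p : IntValued) :
    (p : Polynomial ℚ).eval (k : ℚ) = evalInt k p :=
  Classical.choose_spec (p.2 k)

/-- `p` is a polynomial with `p(n) = a_{λμ}^ν(n)` for all `n ≥ |ν| + ℓ(ν)`. -/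
def IsStructurePolynomial (la mu nu : EvenPartition) (p : IntValued) : Prop :=
  ∀ n : ℕ, nu.size + nu.length ≤ n → evalInt n p = structConst n la mu nu

/-- The structure polynomial `f_{λμ}^ν(x)`. -/
def structPoly (la mu nu : EvenPartition) : IntValued :=
  Classical.epsilon (IsStructurePolynomial la mu nu)

/-! ### The spin FH-algebra -/

/-- The underlying `𝔹`-module of the spin FH-algebra `𝒦`: free on the even partitions. -/
def SpinFH : Type := EvenPartition →₀ IntValued

namespace SpinFH

instance : AddCommGroup SpinFH := inferInstanceAs (AddCommGroup (EvenPartition →₀ IntValued))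

instance : Module IntValued SpinFH :=
  inferInstanceAs (Module IntValued (EvenPartition →₀ IntValued))

/-- The basis `d_λ` of `𝒦` over `𝔹`. -/
def d : Module.Basis EvenPartition IntValued SpinFH :=
  .ofRepr (LinearEquiv.refl IntValued (EvenPartition →₀ IntValued))

/-- The `𝔹`-bilinear multiplication with `d_λ d_μ = ∑_{|ν| ≤ |λ| + |μ|} f_{λμ}^ν d_ν`. -/
def mulMap : SpinFH →ₗ[IntValued] SpinFH →ₗ[IntValued] SpinFH :=
  d.constr IntValued fun la => d.constr IntValued fun mu =>
    ∑ nu ∈ EvenPartition.sizeLE (la.size + mu.size), structPoly la mu nu • d nu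

instance : NonUnitalNonAssocRing SpinFH where
  mul a b := mulMap a b
  left_distrib a b c := map_add (mulMap a) b c
  right_distrib a b c := LinearMap.map_add₂ mulMap a b c
  zero_mul a := LinearMap.map_zero₂ mulMap a
  mul_zero a := map_zero (mulMap a)

theorem mul_def (a b : SpinFH) : a * b = mulMap a b := rfl

instance : IsScalarTower IntValued SpinFH SpinFH where
  smul_assoc c a b := LinearMap.map_smul₂ mulMap c a b

instance : SMulCommClass IntValued SpinFH SpinFH where
  smul_comm c a b := (map_smul (mulMap a) c b).symm

theorem d_mul_d (la mu : EvenPartition) :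
    d la * d mu =
      ∑ nu ∈ EvenPartition.sizeLE (la.size + mu.size), structPoly la mu nu • d nu := by
  simp [mul_def, mulMap]

end SpinFH

end SpinSym

end

noncomputable section

namespace SpinSym

open Equiv

/-! ### Basic relations in the cover -/

/-! The cover is a central extension of `S_n` with kernel `{1, z}` of order two. The kernel is no
larger by induction over cosets (`proj_eq_one`), and `z ≠ 1` because `z` acts as `-1` in a Clifford
algebra (`z_ne_one`).

Since `z = -1` in the spin group algebra, an element is determined by its coefficients `spinCoef n
g`, which change sign under `g ↦ zg`. For an even central element they are constant on conjugacy
classes, so they vanish where `g` is conjugate to `zg`. Lifts of disjoint odd permutations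
anticommute, so an even permutation with a cycle of even length has only such lifts
(`isConj_z_mul`). If all cycles are odd, `g` and `zg` are not conjugate (`not_isConj_z_mul`). Hence
the nonzero `d_ν(n)` form a `ℤ`-basis of the even center (`evenCenter_eq_sum`,
`spinCoef_tLift_sum`), which gives the structure constants.

Polynomiality is a count. The structure constant is the signed number of pairs `(g, h)` in `D_λ ×
D_μ` with `gh = t_ν` or `gh = z t_ν`. As `t_ν` is compatible with the inclusions
(`incl_tLift_succ`), all `n ≤ N` can be treated in the cover of `S_N`. Sort the pairs by the set `V`
of points that they move beyond the first `m = |ν| + ℓ(ν)` ones. Lifts of permutations fixing the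
first `m` points commute with the even element `t_ν`, so the count depends only on `|V|`
(`suppCount_eq_of_card_eq`), and it vanishes when `V` is large. This yields `∑ c_k binom(n - m, k)`
with integers `c_k`.

Restricting products in `𝒦` to `|ν| ≤ |λ| + |μ|` loses nothing: `|λ|` is the reflection length,
which is subadditive (`structConst_eq_zero_of_size`). So every specialization is multiplicative.
Jointly they are injective, as polynomials are determined by their values at large integers
(`specialize_ext`), and `𝒦` inherits the ring axioms from the even centers. -/

theorem t_of {n i : ℕ} (h₁ : 1 ≤ i) (h₂ : i < n) : t n i = PresentedGroup.of (.t i h₁ h₂) :=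
  dif_pos ⟨h₁, h₂⟩

theorem relator_eq_one {n : ℕ} {r : FreeGroup (Gen n)} (hr : Relator n r) :
    PresentedGroup.mk {r : FreeGroup (Gen n) | Relator n r} r = 1 :=
  PresentedGroup.one_of_mem hr

theorem z_mul_z (n : ℕ) : z n * z n = 1 := by
  have := relator_eq_one (Relator.z_sq (n := n))
  rwa [map_pow, pow_two] at this

theorem z_inv (n : ℕ) : (z n)⁻¹ = z n := inv_eq_of_mul_eq_one_left (z_mul_z n)

theorem t_mul_t {n i : ℕ} (h₁ : 1 ≤ i) (h₂ : i < n) : t n i * t n i = z n := by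
  have := relator_eq_one (Relator.t_sq i h₁ h₂)
  rw [t_of h₁ h₂, ← pow_two]
  rwa [map_mul, map_pow, map_inv, mul_inv_eq_one] at this

theorem t_braid {n i : ℕ} (h₁ : 1 ≤ i) (h₂ : i + 1 < n) :
    t n i * t n (i + 1) * t n i = t n (i + 1) * t n i * t n (i + 1) := by
  have := relator_eq_one (Relator.braid i h₁ (by omega) (by omega) h₂)
  rw [t_of h₁ (by omega), t_of (by omega) h₂]
  rw [map_mul, map_inv, mul_inv_eq_one, map_mul, map_mul, map_mul, map_mul] at this
  exact this

theorem t_far {n i j : ℕ} (h₁ : 1 ≤ i) (h₂ : i < n) (k₁ : 1 ≤ j) (k₂ : j < n)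
    (hij : i + 1 < j ∨ j + 1 < i) : t n j * t n i = z n * t n i * t n j := by
  have := relator_eq_one (Relator.far i j h₁ h₂ k₁ k₂ hij)
  rw [t_of h₁ h₂, t_of k₁ k₂]
  rw [map_mul, map_mul, map_inv, mul_inv_eq_one, map_mul, map_mul] at this
  exact this

/-- Since `z⁻¹ = z` and `t_i⁻¹ = t_i z`, the generators already generate the cover as a monoid. -/
theorem cover_induction {n : ℕ} {p : Cover n → Prop} (one : p 1)
    (mul_z : ∀ g, p g → p (g * z n))
    (mul_t : ∀ g i, 1 ≤ i → i < n → p g → p (g * t n i)) (g : Cover n) : p g := by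
  have hg : g ∈ Subgroup.closure
      (Set.range (PresentedGroup.of (rels := {r : FreeGroup (Gen n) | Relator n r}))) := by
    rw [PresentedGroup.closure_range_of]; trivial
  induction hg using Subgroup.closure_induction_right with
  | one => exact one
  | mul_right x hx y hy ih =>
    obtain ⟨a, rfl⟩ := hy
    cases a with
    | z => exact mul_z _ ih
    | t i h₁ h₂ => rw [← t_of h₁ h₂]; exact mul_t _ i h₁ h₂ ih
  | mul_inv_cancel x hx y hy ih =>
    obtain ⟨a, rfl⟩ := hy
    cases a with
    | z =>
      change p (x * (z n)⁻¹)
      rw [z_inv]; exact mul_z _ ih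
    | t i h₁ h₂ =>
      rw [← t_of h₁ h₂]
      have : (t n i)⁻¹ = t n i * z n := by
        rw [inv_eq_iff_mul_eq_one, ← mul_assoc, t_mul_t h₁ h₂, z_mul_z]
      rw [this, ← mul_assoc]
      exact mul_z _ (mul_t _ i h₁ h₂ ih)

theorem commute_z {n : ℕ} (g : Cover n) : Commute (z n) g := by
  induction g using cover_induction with
  | one => exact Commute.one_right _
  | mul_z g hg => exact hg.mul_right (Commute.refl _)
  | mul_t g i h₁ h₂ hg =>
    refine hg.mul_right ?_
    have := relator_eq_one (Relator.z_central i h₁ h₂)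
    rw [map_mul, map_inv, mul_inv_eq_one, map_mul, map_mul] at this
    rw [t_of h₁ h₂]
    exact this

theorem z_mul_cancel {n : ℕ} (g : Cover n) : z n * (z n * g) = g := by
  rw [← mul_assoc, z_mul_z, one_mul]

theorem t_inv {n i : ℕ} (h₁ : 1 ≤ i) (h₂ : i < n) : (t n i)⁻¹ = z n * t n i := by
  rw [inv_eq_iff_mul_eq_one, ← mul_assoc, ← (commute_z _).eq, mul_assoc, t_mul_t h₁ h₂, z_mul_z]

/-! ### The element `z` is non-trivial -/

/-- The values on a basis of a bilinear form whose symmetrization is the negative of the Cartan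
matrix of type `A`. -/
def cartanForm : LinearMap.BilinMap ℚ (ℕ →₀ ℚ) ℚ :=
  (Finsupp.basisSingleOne (R := ℚ) (ι := ℕ)).constr ℚ fun i =>
    (Finsupp.basisSingleOne (R := ℚ) (ι := ℕ)).constr ℚ fun j =>
      if i = j then -1 else if i + 1 = j then 1 else 0

theorem cartanForm_single (i j : ℕ) :
    cartanForm (Finsupp.single i 1) (Finsupp.single j 1) =
      if i = j then -1 else if i + 1 = j then 1 else 0 := by
  have h : ∀ i : ℕ, (Finsupp.single i 1 : ℕ →₀ ℚ) = Finsupp.basisSingleOne (R := ℚ) i := by simp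
  rw [cartanForm, h, h, Module.Basis.constr_basis, Module.Basis.constr_basis]

/-- The Clifford algebra of type `A`. -/
abbrev Cliff : Type := CliffordAlgebra (LinearMap.BilinMap.toQuadraticMap cartanForm)

/-- The generators of the Clifford algebra of type `A`. -/
def cliffGen (i : ℕ) : Cliff := CliffordAlgebra.ι _ (Finsupp.single i 1)

theorem cliffGen_mul_self (i : ℕ) : cliffGen i * cliffGen i = -1 := by
  rw [cliffGen, CliffordAlgebra.ι_sq_scalar]
  simp [cartanForm_single]

/-- The polar form of neighbouring basis vectors is `1`. Together with `e_i² = -1` this makes both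
sides of the braid relation equal to `e_i + e_{i+1}`. -/
theorem cliffGen_succ (i : ℕ) :
    cliffGen i * cliffGen (i + 1) = 1 - cliffGen (i + 1) * cliffGen i := by
  rw [eq_sub_iff_add_eq, cliffGen, cliffGen, CliffordAlgebra.ι_mul_ι_add_swap]
  have h : ¬ i + 1 + 1 = i := by omega
  simp [QuadraticMap.polar, cartanForm_single, h]

theorem cliffGen_far {i j : ℕ} (h : i + 1 < j ∨ j + 1 < i) :
    cliffGen j * cliffGen i = -(cliffGen i * cliffGen j) := by
  rw [eq_neg_iff_add_eq_zero, cliffGen, cliffGen, CliffordAlgebra.ι_mul_ι_add_swap]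
  simp only [QuadraticMap.polar, map_add, LinearMap.BilinMap.toQuadraticMap_apply,
    LinearMap.add_apply, cartanForm_single]
  rw [if_neg (by omega : ¬ i = j), if_neg (by omega : ¬ j = i),
    if_neg (by omega : ¬ i + 1 = j), if_neg (by omega : ¬ j + 1 = i)]
  simp

/-- The generators of the Clifford algebra as units. -/
def cliffUnit (i : ℕ) : Cliffˣ :=
  ⟨cliffGen i, -cliffGen i, by simp [cliffGen_mul_self], by simp [cliffGen_mul_self]⟩

/-- The spin representation of the cover. -/
def spinRep (n : ℕ) : Cover n →* Cliffˣ :=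
  PresentedGroup.toGroup
    (f := fun g : Gen n => match g with
      | .z => -1
      | .t i _ _ => cliffUnit i)
    (by
      intro r hr
      cases hr with
      | z_central i h₁ h₂ => simp
      | z_sq => simp
      | t_sq i h₁ h₂ =>
        ext; simp [cliffUnit, pow_two, cliffGen_mul_self]
      | braid i h₁ h₂ k₁ k₂ =>
        simp only [map_mul, map_inv, FreeGroup.lift_apply_of, mul_inv_eq_one]
        ext
        simp only [cliffUnit, Units.val_mul]
        rw [cliffGen_succ, sub_mul, mul_assoc, cliffGen_mul_self, mul_assoc (cliffGen (i + 1)),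
          cliffGen_succ, mul_sub, ← mul_assoc, cliffGen_mul_self]
        simp [add_comm]
      | far i j h₁ h₂ k₁ k₂ hij =>
        simp only [map_mul, map_inv, FreeGroup.lift_apply_of, mul_inv_eq_one]
        ext
        simp [cliffUnit, cliffGen_far hij])

/-- The spin representation sends `z` to `-1`, which differs from `1` in a nonzero `ℚ`-algebra. -/
theorem z_ne_one (n : ℕ) : z n ≠ 1 := by
  intro h
  have h₁ : spinRep n (z n) = -1 := PresentedGroup.toGroup.of _
  rw [h, map_one] at h₁
  have h₂ : (1 : Cliff) = -1 := by simpa using congrArg Units.val h₁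
  have h₃ : (2 : Cliff) = 0 := by
    rw [← one_add_one_eq_two, eq_neg_iff_add_eq_zero.1 h₂]
  have : CharZero Cliff := algebraRat.charZero Cliff
  exact two_ne_zero h₃

theorem z_mul_ne {n : ℕ} (g : Cover n) : z n * g ≠ g := by simpa using z_ne_one n

/-! ### The projection to the symmetric group -/

theorem swap_braid {α : Type*} [DecidableEq α] {a b c : α} (hab : a ≠ b) (hac : a ≠ c)
    (hbc : b ≠ c) :
    swap a b * swap b c * swap a b = swap b c * swap a b * swap b c := by
  have e₁ := swap_mul_swap_mul_swap (x := c) (y := b) (z := a) hbc.symm hac.symm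
  have e₂ := swap_mul_swap_mul_swap (x := a) (y := b) (z := c) hab hac
  rw [swap_comm b a, swap_comm c b] at e₁
  rw [e₁, e₂, swap_comm]

/-- The permutations under the generators of the cover. -/
def projGen (n : ℕ) : Gen n → Perm (Fin n)
  | .z => 1
  | .t i _ h₂ => swap ⟨i - 1, lt_of_le_of_lt (Nat.sub_le i 1) h₂⟩ ⟨i, h₂⟩

/-- The projection of the cover of `S_n` to `S_n`. -/
def proj (n : ℕ) : Cover n →* Perm (Fin n) :=
  PresentedGroup.toGroup (f := projGen n)
    (by
      intro r hr
      cases hr with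
      | z_central i h₁ h₂ => simp [projGen]
      | z_sq => simp [projGen]
      | t_sq i h₁ h₂ => simp [projGen, pow_two]
      | braid i h₁ h₂ k₁ k₂ =>
        simp only [map_mul, map_inv, FreeGroup.lift_apply_of, mul_inv_eq_one, projGen]
        have h₀ : i + 1 - 1 = i := by omega
        simp only [h₀]
        exact swap_braid (by rw [Ne, Fin.mk.injEq]; omega) (by rw [Ne, Fin.mk.injEq]; omega)
          (by rw [Ne, Fin.mk.injEq]; omega)
      | far i j h₁ h₂ k₁ k₂ hij =>
        simp only [map_mul, map_inv, FreeGroup.lift_apply_of, mul_inv_eq_one, projGen, one_mul]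
        refine (Perm.Disjoint.commute ?_).eq
        rw [Perm.disjoint_iff_disjoint_support, Perm.support_swap (by simp; omega),
          Perm.support_swap (by simp; omega)]
        simp
        omega)

@[simp] theorem proj_z (n : ℕ) : proj n (z n) = 1 := PresentedGroup.toGroup.of _

theorem proj_t {n i : ℕ} (h₁ : 1 ≤ i) (h₂ : i < n) :
    proj n (t n i) = swap ⟨i - 1, by omega⟩ ⟨i, h₂⟩ := by
  rw [t_of h₁ h₂]
  exact PresentedGroup.toGroup.of _

/-- The natural homomorphism from the cover of `S_n` to the cover of `S_N` for `n ≤ N`. -/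
def inclTo {n N : ℕ} (h : n ≤ N) : Cover n →* Cover N :=
  PresentedGroup.toGroup
    (f := fun g : Gen n => match g with
      | .z => PresentedGroup.of .z
      | .t i h₁ h₂ => PresentedGroup.of (.t i h₁ (lt_of_lt_of_le h₂ h)))
    (by
      intro r hr
      cases hr with
      | z_central i h₁ h₂ =>
        simpa [PresentedGroup.of] using relator_eq_one (.z_central i h₁ (lt_of_lt_of_le h₂ h))
      | z_sq => simpa [PresentedGroup.of] using relator_eq_one (n := N) .z_sq
      | t_sq i h₁ h₂ =>
        simpa [PresentedGroup.of] using relator_eq_one (.t_sq i h₁ (lt_of_lt_of_le h₂ h))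
      | braid i h₁ h₂ k₁ k₂ =>
        simpa [PresentedGroup.of] using
          relator_eq_one (.braid i h₁ (lt_of_lt_of_le h₂ h) k₁ (lt_of_lt_of_le k₂ h))
      | far i j h₁ h₂ k₁ k₂ hij =>
        simpa [PresentedGroup.of] using
          relator_eq_one (.far i j h₁ (lt_of_lt_of_le h₂ h) k₁ (lt_of_lt_of_le k₂ h) hij))

@[simp] theorem inclTo_z {n N : ℕ} (h : n ≤ N) : inclTo h (z n) = z N :=
  PresentedGroup.toGroup.of _

theorem inclTo_t {n N i : ℕ} (h : n ≤ N) (h₁ : 1 ≤ i) (h₂ : i < n) :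
    inclTo h (t n i) = t N i := by
  rw [t_of h₁ h₂, t_of h₁ (lt_of_lt_of_le h₂ h)]
  exact PresentedGroup.toGroup.of _

theorem cover_hom_ext {n : ℕ} {G : Type*} [Group G] {f g : Cover n →* G} (hz : f (z n) = g (z n))
    (ht : ∀ i, 1 ≤ i → i < n → f (t n i) = g (t n i)) : f = g := by
  refine PresentedGroup.ext fun a => ?_
  cases a with
  | z => exact hz
  | t i h₁ h₂ => rw [← t_of h₁ h₂]; exact ht i h₁ h₂

theorem incl_eq_inclTo (n : ℕ) : incl n = inclTo (Nat.le_succ n) := rfl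

@[simp] theorem incl_z (n : ℕ) : incl n (z n) = z (n + 1) := inclTo_z (Nat.le_succ n)

theorem incl_t {n i : ℕ} (h₁ : 1 ≤ i) (h₂ : i < n) : incl n (t n i) = t (n + 1) i :=
  inclTo_t (Nat.le_succ n) h₁ h₂

theorem inclTo_self (n : ℕ) (g : Cover n) : inclTo le_rfl g = g := by
  have : inclTo (le_refl n) = MonoidHom.id _ :=
    cover_hom_ext (by simp) fun i h₁ h₂ => by simp [inclTo_t _ h₁ h₂]
  rw [this]; rfl

theorem incl_inclTo {n N : ℕ} (h : n ≤ N) (g : Cover n) :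
    incl N (inclTo h g) = inclTo (Nat.le_succ_of_le h) g := by
  have : (incl N).comp (inclTo h) = inclTo (Nat.le_succ_of_le h) :=
    cover_hom_ext (by simp) fun i h₁ h₂ => by
      simp [inclTo_t _ h₁ h₂, incl_t h₁ (lt_of_lt_of_le h₂ h)]
  rw [← this]; rfl

/-- `{0, …, n-1}` as a subtype of `{0, …, N-1}`. -/
def finSubtypeEquiv {n N : ℕ} (h : n ≤ N) : Fin n ≃ {x : Fin N // x.val < n} where
  toFun x := ⟨Fin.castLE h x, x.2⟩
  invFun y := ⟨y.1.1, y.2⟩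
  left_inv _ := rfl
  right_inv _ := rfl

theorem proj_inclTo {n N : ℕ} (h : n ≤ N) (g : Cover n) :
    proj N (inclTo h g) = (proj n g).extendDomain (finSubtypeEquiv h) := by
  have : (proj N).comp (inclTo h) =
      (Perm.extendDomainHom (finSubtypeEquiv h)).comp (proj n) := by
    refine cover_hom_ext (by simp) fun i h₁ h₂ => ?_
    simp only [MonoidHom.comp_apply, inclTo_t h h₁ h₂, proj_t h₁ h₂,
      proj_t h₁ (lt_of_lt_of_le h₂ h), Perm.extendDomainHom_apply]
    ext y
    by_cases hy : y.val < n
    · rw [Perm.extendDomain_apply_subtype (p := fun x : Fin N => x.val < n) _ _ hy]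
      simp only [finSubtypeEquiv, coe_fn_symm_mk, coe_fn_mk, swap_apply_def, Fin.ext_iff]
      split_ifs <;> rfl
    · rw [Perm.extendDomain_apply_not_subtype (p := fun x : Fin N => x.val < n) _ _ hy,
        swap_apply_of_ne_of_ne] <;>
        · rw [Ne, Fin.ext_iff]; simp only; omega
  exact DFunLike.congr_fun this g

theorem proj_inclTo_castLE {n N : ℕ} (h : n ≤ N) (g : Cover n) (x : Fin n) :
    proj N (inclTo h g) (Fin.castLE h x) = Fin.castLE h (proj n g x) := by
  rw [proj_inclTo]
  exact Perm.extendDomain_apply_image (proj n g) (finSubtypeEquiv h) x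

theorem proj_inclTo_of_le {n N : ℕ} (h : n ≤ N) (g : Cover n) (x : Fin N) (hx : n ≤ x) :
    proj N (inclTo h g) x = x := by
  rw [proj_inclTo, Perm.extendDomain_apply_not_subtype (p := fun x : Fin N => x.val < n) _ _
    (not_lt.2 hx)]

/-! ### Coset representatives -/

/-- The product `t_n t_{n-1} ⋯ t_{n-k+1}` in the cover of `S_{n+1}`. -/
def descent (n : ℕ) : ℕ → Cover (n + 1)
  | 0 => 1
  | k + 1 => descent n k * t (n + 1) (n - k)

/-- Here `t_i` is far from every factor `t_n, …, t_{n-k+1}`, so it passes to the left at the cost of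
powers of `z`. -/
theorem descent_mul_t_low (n k i : ℕ) (h₁ : 1 ≤ i) (h : i + k < n) :
    ∃ h : Cover n, descent n k * t (n + 1) i = incl n h * descent n k := by
  induction k with
  | zero => exact ⟨t n i, by simp [descent, incl_t h₁ (by omega : i < n)]⟩
  | succ k ih =>
    obtain ⟨h', hh'⟩ := ih (by omega)
    refine ⟨z n * h', ?_⟩
    rw [descent, mul_assoc, t_far h₁ (by omega) (by omega) (by omega) (Or.inl (by omega)),
      mul_assoc, ← mul_assoc, ← (commute_z (descent n k)).eq, mul_assoc, ← mul_assoc (descent n k),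
      hh', map_mul, incl_z]
    simp only [mul_assoc]

/-- The generator `t_i` passes the far factors on the right until it meets `t_i t_{i-1}`. There the
braid relation gives `t_i t_{i-1} t_i = t_{i-1} t_i t_{i-1}`, and the leading `t_{i-1}` passes to
the left as in `descent_mul_t_low`. -/
theorem descent_mul_t_high (n k i : ℕ) (hk : k ≤ n) (hi : i ≤ n) (h : n + 1 < i + k) :
    ∃ h : Cover n, descent n k * t (n + 1) i = incl n h * descent n k := by
  induction k with
  | zero => omega
  | succ k ih =>
    rcases Nat.lt_or_ge (n + 1) (i + k) with h' | h'
    · obtain ⟨h', hh'⟩ := ih (by omega) h'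
      refine ⟨z n * h', ?_⟩
      rw [descent, mul_assoc, t_far (i := i) (by omega) (by omega) (by omega) (by omega)
          (Or.inr (by omega)),
        mul_assoc, ← mul_assoc, ← (commute_z (descent n k)).eq, mul_assoc,
        ← mul_assoc (descent n k), hh', map_mul, incl_z]
      simp only [mul_assoc]
    · obtain ⟨m, rfl⟩ : ∃ m, k = m + 1 := ⟨k - 1, by omega⟩
      obtain ⟨j, rfl⟩ : ∃ j, i = j + 1 := ⟨i - 1, by omega⟩
      obtain ⟨h', hh'⟩ := descent_mul_t_low n m j (by omega) (by omega)
      refine ⟨h', ?_⟩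
      have e₁ : n - m = j + 1 := by omega
      have e₂ : n - (m + 1) = j := by omega
      rw [descent, descent, e₁, e₂, mul_assoc, mul_assoc,
        ← mul_assoc (t (n + 1) (j + 1)), ← t_braid (by omega) (by omega), mul_assoc,
        ← mul_assoc (descent n m), hh']
      simp only [mul_assoc]

/-- Right multiplication by `t_i` permutes the `n + 1` cosets represented by the descents: it
lengthens a descent if `i + k = n`, shortens it up to `z` if `i + k = n + 1`, and otherwise keeps
its coset. -/
theorem exists_incl_mul_descent (n : ℕ) (g : Cover (n + 1)) :
    ∃ (h : Cover n) (k : ℕ), k ≤ n ∧ g = incl n h * descent n k := by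
  induction g using cover_induction with
  | one => exact ⟨1, 0, Nat.zero_le _, by simp [descent]⟩
  | mul_z g hg =>
    obtain ⟨h, k, hk, rfl⟩ := hg
    exact ⟨z n * h, k, hk, by rw [← (commute_z _).eq, map_mul, incl_z, mul_assoc]⟩
  | mul_t g i h₁ h₂ hg =>
    obtain ⟨h, k, hk, rfl⟩ := hg
    rcases lt_trichotomy (i + k) n with h' | h' | h'
    · obtain ⟨h', hh'⟩ := descent_mul_t_low n k i h₁ h'
      exact ⟨h * h', k, hk, by rw [mul_assoc, hh', map_mul, mul_assoc]⟩
    · refine ⟨h, k + 1, by omega, ?_⟩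
      have e : n - k = i := by omega
      rw [descent, e, mul_assoc]
    · rcases (Nat.succ_le_of_lt h').eq_or_lt with h' | h'
      · obtain ⟨m, rfl⟩ : ∃ m, k = m + 1 := ⟨k - 1, by omega⟩
        refine ⟨z n * h, m, by omega, ?_⟩
        have e : n - m = i := by omega
        rw [descent, e, mul_assoc, mul_assoc, t_mul_t h₁ h₂, ← (commute_z _).eq, map_mul, incl_z,
          ← mul_assoc, (commute_z (incl n h)).eq]
      · obtain ⟨h', hh'⟩ := descent_mul_t_high n k i hk (by omega) h'
        exact ⟨h * h', k, hk, by rw [mul_assoc, hh', map_mul, mul_assoc]⟩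

theorem proj_descent (n k : ℕ) (hk : k ≤ n) :
    proj (n + 1) (descent n k) ⟨n - k, by omega⟩ = Fin.last n := by
  induction k with
  | zero => simp [descent]; rfl
  | succ k ih =>
    rw [descent, map_mul, Perm.mul_apply, proj_t (by omega) (by omega)]
    have : (⟨n - (k + 1), by omega⟩ : Fin (n + 1)) = ⟨n - k - 1, by omega⟩ := by
      ext; simp only; omega
    rw [this, swap_apply_left]
    exact ih (by omega)

/-! ### Kernel and image of the projection, and images of the inclusions -/

theorem mem_range_incl {n : ℕ} {g : Cover (n + 1)}
    (hg : proj (n + 1) g (Fin.last n) = Fin.last n) : ∃ h : Cover n, incl n h = g := by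
  obtain ⟨h, k, hk, rfl⟩ := exists_incl_mul_descent n g
  refine ⟨h, ?_⟩
  have h₁ : proj (n + 1) (incl n h) (Fin.last n) = Fin.last n :=
    proj_inclTo_of_le (Nat.le_succ n) h _ le_rfl
  have h₂ : proj (n + 1) (descent n k) (Fin.last n) = Fin.last n := by
    apply (proj (n + 1) (incl n h)).injective
    rw [← Perm.mul_apply, ← map_mul, hg, h₁]
  -- The descent of length `k` sends only the point `n - k` to the last point, so it fixes the last
  -- point only for `k = 0`.
  have h₃ := (proj (n + 1) (descent n k)).injective (h₂.trans (proj_descent n k hk).symm)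
  have h₄ : k = 0 := by
    have := congrArg Fin.val h₃
    simp only [Fin.val_last] at this
    omega
  rw [h₄, descent, mul_one]

/-- An element over the identity fixes the last point, so it comes from the cover of the next
smaller symmetric group. -/
theorem proj_eq_one {n : ℕ} {g : Cover n} (hg : proj n g = 1) : g = 1 ∨ g = z n := by
  induction n with
  | zero =>
    clear hg
    induction g using cover_induction with
    | one => exact Or.inl rfl
    | mul_z g hg =>
      rcases hg with rfl | rfl
      · simp
      · simp [z_mul_z]
    | mul_t g i h₁ h₂ => omega
  | succ n ih =>
    obtain ⟨h, rfl⟩ := mem_range_incl (g := g) (by simp [hg])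
    have : proj n h = 1 := by
      rwa [incl_eq_inclTo, proj_inclTo, Perm.extendDomain_eq_one_iff] at hg
    rcases ih this with rfl | rfl
    · simp
    · simp

theorem eq_or_eq_z_mul {n : ℕ} {g h : Cover n} (hgh : proj n g = proj n h) :
    g = h ∨ g = z n * h := by
  have : proj n (g * h⁻¹) = 1 := by simp [hgh]
  rcases proj_eq_one this with h₁ | h₁
  · exact Or.inl (mul_inv_eq_one.1 h₁)
  · exact Or.inr (mul_inv_eq_iff_eq_mul.1 h₁)

theorem inclTo_injective {n N : ℕ} (h : n ≤ N) : Function.Injective (inclTo h) := by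
  rw [injective_iff_map_eq_one]
  intro g hg
  have : proj n g = 1 := by
    rw [← Perm.extendDomain_eq_one_iff (f := finSubtypeEquiv h), ← proj_inclTo, hg, map_one]
  rcases proj_eq_one this with rfl | rfl
  · rfl
  · rw [inclTo_z] at hg
    exact absurd hg (z_ne_one N)

theorem incl_injective (n : ℕ) : Function.Injective (incl n) := inclTo_injective (Nat.le_succ n)

theorem mem_range_inclTo {n N : ℕ} (h : n ≤ N) (g : Cover N)
    (hg : ∀ x : Fin N, n ≤ x → proj N g x = x) : ∃ k : Cover n, inclTo h k = g := by
  induction N, h using Nat.le_induction with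
  | base => exact ⟨g, inclTo_self _ _⟩
  | succ N h ih =>
    obtain ⟨g, rfl⟩ := mem_range_incl (hg (Fin.last N) (by simpa using h))
    obtain ⟨k, rfl⟩ := ih g (fun x hx => by
      have h₁ := hg x.castSucc (by simpa using hx)
      have h₂ : proj (N + 1) (incl N g) x.castSucc = (proj N g x).castSucc :=
        proj_inclTo_castLE (Nat.le_succ N) g x
      exact Fin.castSucc_injective _ (h₂.symm.trans h₁))
    exact ⟨k, (incl_inclTo h k).symm⟩

theorem proj_surjective (n : ℕ) : Function.Surjective (proj n) := by
  rcases n with _ | n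
  · exact fun σ => ⟨1, Subsingleton.elim _ _⟩
  rw [← MonoidHom.range_eq_top, eq_top_iff]
  intro σ _
  have h := Perm.mclosure_swap_castSucc_succ n
  have hσ : σ ∈ Submonoid.closure (Set.range fun i : Fin n => swap i.castSucc i.succ) := by
    rw [h]; trivial
  refine (Submonoid.closure_le (S := (proj (n + 1)).range.toSubmonoid)).2 ?_ hσ
  rintro _ ⟨i, rfl⟩
  exact ⟨t (n + 1) (i + 1), by rw [proj_t (by omega) (by omega)]; rfl⟩

/-- A preimage in the cover of a permutation. -/
def lift {n : ℕ} (σ : Perm (Fin n)) : Cover n := Function.surjInv (proj_surjective n) σ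

@[simp] theorem proj_lift {n : ℕ} (σ : Perm (Fin n)) : proj n (lift σ) = σ :=
  Function.surjInv_eq _ _

instance (n : ℕ) : Finite (Cover n) := by
  refine Finite.of_surjective
    (fun p : Perm (Fin n) × Bool => if p.2 then lift p.1 else z n * lift p.1) fun g => ?_
  rcases eq_or_eq_z_mul (h := lift (proj n g)) (proj_lift (proj n g)).symm with h | h
  · exact ⟨(proj n g, true), by simpa using h.symm⟩
  · exact ⟨(proj n g, false), by simpa using h.symm⟩

instance (n : ℕ) : Fintype (Cover n) := Fintype.ofFinite _

instance (n : ℕ) : DecidableEq (Cover n) := Classical.decEq _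

theorem parity_eq_one_iff {n : ℕ} (g : Cover n) :
    parity n g = 1 ↔ Perm.sign (proj n g) = 1 := by
  suffices h : (parity n g = 1 ∧ Perm.sign (proj n g) = 1) ∨
      (parity n g = Multiplicative.ofAdd 1 ∧ Perm.sign (proj n g) = -1) by
    rcases h with ⟨h₁, h₂⟩ | ⟨h₁, h₂⟩
    · simp [h₁, h₂]
    · simp [h₁, h₂]
  have hz : parity n (z n) = 1 := PresentedGroup.toGroup.of _
  induction g using cover_induction with
  | one => simp
  | mul_z g hg => simpa [hz] using hg
  | mul_t g i h₁ h₂ hg =>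
    have ht : parity n (t n i) = Multiplicative.ofAdd 1 := by
      rw [t_of h₁ h₂]; exact PresentedGroup.toGroup.of _
    have hs : Perm.sign (proj n (t n i)) = -1 := by
      rw [proj_t h₁ h₂, Perm.sign_swap]
      simp only [Ne, Fin.mk.injEq]; omega
    rcases hg with ⟨h₃, h₄⟩ | ⟨h₃, h₄⟩
    · right; simp [ht, hs, h₃, h₄]
    · left
      rw [map_mul, map_mul, map_mul, ht, hs, h₃, h₄]
      exact ⟨by decide, by decide⟩

/-! ### Commutation of elements with disjoint supports -/

theorem exists_perm_comp_eq {α ι : Type*} [Fintype α] (f g : ι → α)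
    (hf : Function.Injective f) (hg : Function.Injective g) : ∃ σ : Perm α, ∀ i, σ (f i) = g i := by
  classical
  let e : {x // x ∈ Set.range f} ≃ {x // x ∈ Set.range g} :=
    (Equiv.ofInjective f hf).symm.trans (Equiv.ofInjective g hg)
  refine ⟨e.extendSubtype, fun i => ?_⟩
  rw [e.extendSubtype_apply_of_mem _ ⟨i, rfl⟩]
  have : (Equiv.ofInjective f hf).symm ⟨f i, ⟨i, rfl⟩⟩ = i := by
    rw [Equiv.symm_apply_eq]; rfl
  simp only [e, Equiv.trans_apply, this]
  rfl

/-- By conjugation this reduces to `t_1` and `t_3`, which anticommute by the far relation. Other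
lifts differ by central factors `z`, which occur equally on both sides. -/
theorem anticommute_swap {n : ℕ} {a b c d : Fin n} (h : [a, b, c, d].Nodup) {g k : Cover n}
    (hg : proj n g = swap a b) (hk : proj n k = swap c d) : g * k = z n * (k * g) := by
  have h4 : 4 ≤ n := by simpa using h.length_le_card
  obtain ⟨σ, hσ⟩ := exists_perm_comp_eq (Fin.castLE h4) [a, b, c, d].get
    (Fin.castLE_injective h4) (List.nodup_iff_injective_get.1 h)
  have h0 : σ ⟨0, by omega⟩ = a := hσ 0
  have h1 : σ ⟨1, by omega⟩ = b := hσ 1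
  have h2 : σ ⟨2, by omega⟩ = c := hσ 2
  have h3 : σ ⟨3, by omega⟩ = d := hσ 3
  have e₁ : proj n (lift σ * t n 1 * (lift σ)⁻¹) = swap a b := by
    rw [map_mul, map_mul, map_inv, proj_lift, proj_t le_rfl (by omega), ← h0, ← h1,
      swap_apply_apply]
  have e₂ : proj n (lift σ * t n 3 * (lift σ)⁻¹) = swap c d := by
    rw [map_mul, map_mul, map_inv, proj_lift, proj_t (by omega) (by omega), ← h2, ← h3,
      swap_apply_apply]
  have key : (lift σ * t n 1 * (lift σ)⁻¹) * (lift σ * t n 3 * (lift σ)⁻¹) =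
      z n * ((lift σ * t n 3 * (lift σ)⁻¹) * (lift σ * t n 1 * (lift σ)⁻¹)) := by
    have ht : t n 1 * t n 3 = z n * (t n 3 * t n 1) := by
      rw [t_far (i := 3) (j := 1) (by omega) (by omega) (by omega) (by omega) (by omega),
        mul_assoc]
    calc _ = lift σ * (t n 1 * t n 3) * (lift σ)⁻¹ := by group
      _ = (lift σ * z n) * (t n 3 * t n 1) * (lift σ)⁻¹ := by rw [ht]; group
      _ = _ := by rw [← (commute_z (lift σ)).eq]; group
  have hz : ∀ g : Cover n, g * z n = z n * g := fun g => (commute_z g).eq.symm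
  rcases eq_or_eq_z_mul (hg.trans e₁.symm) with rfl | rfl <;>
  rcases eq_or_eq_z_mul (hk.trans e₂.symm) with rfl | rfl
  · exact key
  · rw [← mul_assoc, hz, mul_assoc, key]; simp only [mul_assoc]
  · rw [mul_assoc, key, ← mul_assoc (_ * _) (z n), hz]; simp only [mul_assoc]
  · rw [mul_assoc, ← mul_assoc _ (z n), hz, mul_assoc, key, mul_assoc (z n) _ (z n * _),
      ← mul_assoc _ (z n) (lift σ * t n 1 * (lift σ)⁻¹), hz, mul_assoc (z n)]

/-- The central element by which lifts of disjoint permutations of signs `u` and `v` commute. -/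
def signZ (n : ℕ) (u v : ℤˣ) : Cover n := if u = -1 ∧ v = -1 then z n else 1

theorem signZ_mul_left {n : ℕ} (u u' v : ℤˣ) : signZ n (u * u') v = signZ n u v * signZ n u' v := by
  rcases Int.units_eq_one_or u with rfl | rfl <;> rcases Int.units_eq_one_or u' with rfl | rfl <;>
  rcases Int.units_eq_one_or v with rfl | rfl <;> simp [signZ, z_mul_z]

theorem signZ_comm {n : ℕ} (u v : ℤˣ) : signZ n u v = signZ n v u := by
  simp only [signZ, and_comm]

theorem signZ_mul_self {n : ℕ} (u v : ℤˣ) : signZ n u v * signZ n u v = 1 := by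
  rw [signZ]; split_ifs <;> simp [z_mul_z]

theorem commute_signZ {n : ℕ} (u v : ℤˣ) (g : Cover n) : Commute (signZ n u v) g := by
  rw [signZ]; split_ifs
  · exact commute_z g
  · exact Commute.one_left g

/-- A permutation supported on `p` is a product of transpositions supported on `p`, and `signZ` is
multiplicative in its first argument. -/
theorem mul_eq_signZ_of_swap {n : ℕ} {p : Fin n → Prop} [DecidablePred p] (k : Cover n) (s : ℤˣ)
    (H : ∀ x y, p x → p y → x ≠ y → ∀ g, proj n g = swap x y →
      g * k = signZ n (-1) s * (k * g))
    (g : Cover n) (hg : ∀ x, ¬ p x → proj n g x = x) :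
    g * k = signZ n (Perm.sign (proj n g)) s * (k * g) := by
  have aux : ∀ (τ : Perm {x // p x}) (g : Cover n), proj n g = Perm.ofSubtype τ →
      g * k = signZ n (Perm.sign (proj n g)) s * (k * g) := by
    intro τ
    induction τ using Perm.swap_induction_on with
    | one =>
      intro g hg
      rw [map_one] at hg
      have h₁ : signZ n (Perm.sign (proj n g)) s = 1 := by
        rw [hg, signZ, if_neg]; simp
      rw [h₁, one_mul]
      rcases proj_eq_one hg with rfl | rfl
      · simp
      · exact (commute_z k).eq
    | swap_mul f x y hxy ih =>
      intro g hg
      rw [map_mul, Perm.ofSubtype_swap_eq] at hg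
      have hxy' : (x : Fin n) ≠ y := fun h => hxy (Subtype.ext h)
      set l := lift (swap (x : Fin n) y) with hl
      have hl' : proj n l = swap (x : Fin n) y := proj_lift _
      obtain ⟨g', rfl⟩ : ∃ g', g = l * g' := ⟨l⁻¹ * g, by group⟩
      have h₁ : proj n g' = Perm.ofSubtype f := by
        rw [map_mul, hl'] at hg
        exact mul_left_cancel hg
      rw [mul_assoc, ih g' h₁, ← mul_assoc, ← (commute_signZ _ _ l).eq, mul_assoc,
        ← mul_assoc l, H x y x.2 y.2 hxy' l hl', map_mul, map_mul, hl', Perm.sign_swap hxy',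
        signZ_mul_left]
      rw [(commute_signZ (n := n) (-1) s (signZ n (Perm.sign (proj n g')) s)).eq]
      simp only [mul_assoc]
  have hp : ∀ x, p (proj n g x) ↔ p x := by
    intro x
    constructor
    · intro h
      by_contra h'
      rw [hg x h'] at h
      exact h' h
    · intro h
      by_contra h'
      have := (proj n g).injective (hg _ h')
      rw [this] at h'
      exact h' h
  refine aux ((proj n g).subtypePerm hp) g ?_
  rw [Perm.ofSubtype_subtypePerm]
  intro x hx
  by_contra h
  exact hx (hg x h)

/-- `mul_eq_signZ_of_swap` is applied twice: it extends `anticommute_swap` first from a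
transposition to `k`, with the other transposition fixed, and then from a transposition to `g`. -/
theorem mul_eq_signZ_of_disjoint {n : ℕ} {g k : Cover n}
    (h : Perm.Disjoint (proj n g) (proj n k)) :
    g * k = signZ n (Perm.sign (proj n g)) (Perm.sign (proj n k)) * (k * g) := by
  refine mul_eq_signZ_of_swap (p := fun x => proj n k x = x) k _ ?_ g
    fun x hx => (h x).resolve_right hx
  intro a b ha hb hab l hl
  have := mul_eq_signZ_of_swap (p := fun x => x ≠ a ∧ x ≠ b) l (-1) ?_ k ?_
  · rw [this, signZ_comm, ← mul_assoc, signZ_mul_self, one_mul]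
  · intro x y hx hy hxy g' hg'
    have h₀ : signZ n (-1) (-1) = z n := by simp [signZ]
    rw [h₀]
    refine anticommute_swap (a := x) (b := y) (c := a) (d := b) ?_ hg' hl
    simp [hx.1, hx.2, hy.1, hy.2, hxy, hab]
  · intro x hx
    rcases eq_or_ne x a with rfl | h'
    · exact ha
    · have : x = b := by
        by_contra h''
        exact hx ⟨h', h''⟩
      rw [this]; exact hb

theorem commute_of_disjoint {n : ℕ} {g k : Cover n}
    (h : Perm.Disjoint (proj n g) (proj n k)) (hk : Perm.sign (proj n k) = 1) : Commute g k := by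
  have := mul_eq_signZ_of_disjoint h
  rw [hk, signZ, if_neg (fun h => by revert h; simp), one_mul] at this
  exact this

/-! ### Split and non-split classes -/

theorem z_pow_odd {n m : ℕ} (hm : Odd m) : z n ^ m = z n := by
  obtain ⟨k, rfl⟩ := hm
  rw [pow_succ, pow_mul, pow_two, z_mul_z, one_pow, one_mul]

/-- With `m` the odd order of the permutation, `g ^ m` is `1` or `z`, while `(zg) ^ m = z g ^ m` is
the other one. These two central elements are not conjugate. -/
theorem not_isConj_z_mul {n : ℕ} {g : Cover n} (hg : Odd (orderOf (proj n g))) :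
    ¬ IsConj g (z n * g) := by
  intro h
  have h₁ := h.pow (orderOf (proj n g))
  rw [(commute_z g).mul_pow, z_pow_odd hg] at h₁
  have h₂ : proj n (g ^ orderOf (proj n g)) = 1 := by rw [map_pow, pow_orderOf_eq_one]
  rcases proj_eq_one h₂ with h₃ | h₃
  · rw [h₃, mul_one, isConj_comm, isConj_one_left] at h₁
    exact z_ne_one n h₁
  · rw [h₃, z_mul_z, isConj_one_left] at h₁
    exact z_ne_one n h₁

/-- Split off a cycle of even length. It is odd, and so is the rest because the whole is even. Hence
their lifts anticommute, and conjugation by the lift of the cycle multiplies `g` by `z`. -/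
theorem isConj_z_mul {n : ℕ} {g : Cover n} (hs : Perm.sign (proj n g) = 1) {m : ℕ}
    (hm : m ∈ (proj n g).cycleType) (he : Even m) : IsConj g (z n * g) := by
  obtain ⟨c, τ, hc, hd, hcyc, hcard⟩ := Perm.mem_cycleType_iff.1 hm
  obtain ⟨k, rfl⟩ : ∃ k, g = lift c * k := ⟨(lift c)⁻¹ * g, by group⟩
  have hk : proj n k = τ := by
    rw [map_mul, proj_lift] at hc
    exact mul_left_cancel hc
  have hcs : Perm.sign c = -1 := by
    rw [hcyc.sign, hcard, he.neg_one_pow]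
  have hτ : Perm.sign τ = -1 := by
    rw [map_mul, proj_lift, hk, map_mul, hcs] at hs
    rcases Int.units_eq_one_or (Perm.sign τ) with h | h
    · rw [h] at hs; exact absurd hs (by decide)
    · exact h
  have key := mul_eq_signZ_of_disjoint (g := lift c) (k := k) (by rwa [proj_lift, hk])
  rw [proj_lift, hk, hcs, hτ, signZ, if_pos ⟨rfl, rfl⟩] at key
  rw [isConj_iff]
  refine ⟨lift c, ?_⟩
  rw [mul_inv_eq_iff_eq_mul]
  calc lift c * (lift c * k) = lift c * (z n * (k * lift c)) := by rw [← key]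
    _ = z n * (lift c * k) * lift c := by
      rw [← mul_assoc, ← (commute_z (lift c)).eq]; simp only [mul_assoc]

/-! ### The elements `x_i` and cycles -/

theorem x_self (n : ℕ) : x n n = t (n + 1) n := by simp [x]

theorem x_of_lt {n i : ℕ} (h : i < n) : x n i = t (n + 1) i * x n (i + 1) * t (n + 1) i := by
  have : n - i = n - (i + 1) + 1 := by omega
  simp only [x, this, List.range'_succ, List.map_cons, List.prod_cons, List.reverse_cons,
    List.map_append, List.prod_append, List.map_nil, List.prod_nil, mul_one, mul_assoc]

/-- The point of `{0, …, n}` which represents the number `i` of `{1, …, n+1}`. -/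
def pt (n i : ℕ) : Fin (n + 1) := ⟨min (i - 1) n, by omega⟩

theorem pt_injOn {n i j : ℕ} (hi : 1 ≤ i) (hj : 1 ≤ j) (hj' : j ≤ n)
    (h : pt n i = pt n j) : i = j := by
  simp only [pt, Fin.mk.injEq] at h
  omega

theorem pt_ne_last {n i : ℕ} (hi : 1 ≤ i) (hi' : i ≤ n) : pt n i ≠ Fin.last n := by
  rw [Ne, Fin.ext_iff]
  simp only [pt, Fin.val_last]
  omega

theorem proj_x {n i : ℕ} (h₁ : 1 ≤ i) (h₂ : i ≤ n) :
    proj (n + 1) (x n i) = swap (pt n i) (Fin.last n) := by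
  revert h₁
  induction h₂ using Nat.decreasingInduction with
  | self =>
    intro h₁
    rw [x_self, proj_t h₁ (by omega)]
    congr 1
    ext; simp [pt]
  | of_succ i h ih =>
    intro h₁
    rw [x_of_lt h, map_mul, map_mul, ih (by omega), proj_t h₁ (by omega)]
    have e₁ : (⟨i, by omega⟩ : Fin (n + 1)) = pt n (i + 1) := by ext; simp [pt]; omega
    have e₂ : (⟨i - 1, by omega⟩ : Fin (n + 1)) = pt n i := by ext; simp [pt]; omega
    rw [e₁, e₂, swap_comm (pt n i), swap_comm (pt n (i + 1)) (Fin.last n), swap_mul_swap_mul_swap]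
    · exact (pt_ne_last (by omega) (by omega)).symm
    · exact (pt_ne_last (by omega) (by omega)).symm

/-- The homomorphism from the cover of `S_m` to the cover of `S_{m+1}` given by the inclusion
followed by conjugation with `t_m`. -/
def conjIncl (m : ℕ) : Cover m →* Cover (m + 1) :=
  (MulAut.conj (t (m + 1) m)).toMonoidHom.comp (incl m)

theorem conjIncl_apply (m : ℕ) (g : Cover m) :
    conjIncl m g = t (m + 1) m * incl m g * (t (m + 1) m)⁻¹ := rfl

theorem conjIncl_t {m i : ℕ} (h₁ : 1 ≤ i) (h₂ : i + 1 < m) :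
    conjIncl m (t m i) = z (m + 1) * t (m + 1) i := by
  rw [conjIncl_apply, incl_t h₁ (by omega), mul_inv_eq_iff_eq_mul,
    t_far h₁ (by omega) (by omega) (by omega) (Or.inl h₂)]

/-- The elements `x_i` for `n` and for `n + 1` lie over different transpositions. Conjugation by
`t_{n+1}` matches them up to `z`, which allows cycles formed at different `n` to be compared. -/
theorem conjIncl_x {n i : ℕ} (h₁ : 1 ≤ i) (h₂ : i ≤ n) :
    conjIncl (n + 1) (x n i) = z (n + 2) * x (n + 1) i := by
  revert h₁
  induction h₂ using Nat.decreasingInduction with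
  | self =>
    intro h₁
    rw [x_self, x_of_lt (by omega : n < n + 1), x_self, conjIncl_apply, incl_t h₁ (by omega),
      t_inv (by omega) (by omega), t_braid h₁ (by omega), ← mul_assoc,
      ← (commute_z (t (n + 1 + 1) (n + 1) * t (n + 1 + 1) n)).eq]
    simp only [mul_assoc]
  | of_succ i h ih =>
    intro h₁
    rw [x_of_lt h, map_mul, map_mul, ih (by omega), conjIncl_t h₁ (by omega),
      x_of_lt (by omega : i < n + 1)]
    have hz := (commute_z (t (n + 2) i)).eq
    calc z (n + 2) * t (n + 2) i * (z (n + 2) * x (n + 1) (i + 1)) * (z (n + 2) * t (n + 2) i)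
        = z (n + 2) * (t (n + 2) i * z (n + 2)) * (x (n + 1) (i + 1) * z (n + 2)) *
            t (n + 2) i := by simp only [mul_assoc]
      _ = _ := by
        rw [← hz, ← (commute_z (x (n + 1) (i + 1))).eq, z_mul_cancel]
        rw [← mul_assoc, ← hz]
        simp only [mul_assoc]

theorem conjIncl_prod_x {n : ℕ} (l : List ℕ) (hl : ∀ i ∈ l, 1 ≤ i ∧ i ≤ n) :
    conjIncl (n + 1) (l.map (x n)).prod = z (n + 2) ^ l.length * (l.map (x (n + 1))).prod := by
  induction l with
  | nil => simp
  | cons a l ih =>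
    have ha := hl a (by simp)
    rw [List.map_cons, List.prod_cons, map_mul, conjIncl_x ha.1 ha.2,
      ih fun i hi => hl i (List.mem_cons_of_mem _ hi), List.length_cons, List.map_cons,
      List.prod_cons, pow_succ', ← mul_assoc, mul_assoc (z (n + 2)),
      ← ((commute_z (x (n + 1) a)).pow_left _).eq]
    simp only [mul_assoc]

theorem z_pow_even {n m : ℕ} (hm : Even m) : z n ^ m = 1 := by
  obtain ⟨k, rfl⟩ := hm
  rw [← two_mul, pow_mul, pow_two, z_mul_z, one_pow]

/-- A cycle of odd length `m > 1` is a product of `m + 1` factors `x_i`. This number is even, so the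
factors `z` from `conjIncl_x` cancel. For `m = 1` the cycle is the central element `z`. -/
theorem conjIncl_cycle {n : ℕ} (l : List ℕ) (hl : ∀ i ∈ l, 1 ≤ i ∧ i ≤ n) (ho : Odd l.length) :
    conjIncl (n + 1) (cycle n l) = cycle (n + 1) l := by
  match l with
  | [] => simp at ho
  | [a] =>
    rw [cycle, cycle, conjIncl_apply, incl_z, mul_inv_eq_iff_eq_mul, (commute_z _).eq]
  | a :: b :: l =>
    have ha := hl a (by simp)
    have h := conjIncl_prod_x (b :: l).reverse
      (fun i hi => hl i (List.mem_cons_of_mem _ (List.mem_reverse.1 hi)))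
    rw [List.length_reverse, z_pow_even (by
      rw [List.length_cons, Nat.odd_add_one, Nat.not_odd_iff_even] at ho
      exact ho), one_mul] at h
    rw [cycle, cycle, map_mul, map_mul, h, conjIncl_x ha.1 ha.2, ← mul_assoc]
    · rw [← (commute_z (z (n + 2) * x (n + 1) a * _)).eq]
      simp only [mul_assoc, z_mul_cancel]
    · simp
    · simp

theorem conjIncl_blockCycles {n : ℕ} (o : ℕ) (ls : List ℕ) (hls : ∀ l ∈ ls, Even l)
    (h : o + (ls.map (· + 1)).sum ≤ n) :
    conjIncl (n + 1) (blockCycles n o ls) = blockCycles (n + 1) o ls := by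
  induction ls generalizing o with
  | nil => simp [blockCycles]
  | cons a ls ih =>
    simp only [List.map_cons, List.sum_cons] at h
    rw [blockCycles, blockCycles, map_mul, conjIncl_cycle,
      ih _ (fun l hl => hls l (List.mem_cons_of_mem _ hl)) (by omega)]
    · intro i hi
      rw [List.mem_range'_1] at hi
      omega
    · rw [List.length_range']
      exact (hls a (by simp)).add_one

/-! ### Permutations under cycles -/

theorem prod_swap_eq_formPerm {α : Type*} [DecidableEq α] (a : α) (l : List α)
    (h : (a :: l).Nodup) : (l.reverse.map fun b => swap b a).prod = (a :: l).formPerm := by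
  induction l using List.reverseRecOn with
  | nil => simp
  | append_singleton l c ih =>
    have h' : (c :: a :: l).Nodup := by
      rw [← List.cons_append, List.nodup_append_comm] at h
      exact h
    rw [List.reverse_append, List.reverse_singleton, List.singleton_append, List.map_cons,
      List.prod_cons, ih (List.nodup_cons.1 h').2, ← List.formPerm_cons_cons,
      ← List.formPerm_rotate _ h' 1]
    simp

theorem swap_formPerm_swap {α : Type*} [DecidableEq α] [Fintype α] (a i : α) (l : List α)
    (hl : l ≠ []) (h : (i :: a :: l).Nodup) :
    swap i a * (a :: l).formPerm * swap i a = (i :: l).formPerm := by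
  match l with
  | b :: l =>
    simp only [List.nodup_cons, List.mem_cons, not_or] at h
    rw [List.formPerm_cons_cons, List.formPerm_cons_cons]
    have hc : Commute (swap i a) (b :: l).formPerm := by
      refine Perm.Disjoint.commute fun y => ?_
      by_cases hy : y = i ∨ y = a
      · right
        refine List.formPerm_apply_of_notMem ?_
        rcases hy with rfl | rfl <;> simp [*]
      · left
        rw [not_or] at hy
        exact swap_apply_of_ne_of_ne hy.1 hy.2
    rw [mul_assoc, mul_assoc, ← hc.eq, ← mul_assoc, ← mul_assoc]
    congr 1
    rw [swap_comm i a, swap_comm a b, swap_mul_swap_mul_swap]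
    · exact fun e => h.2.1.1 e.symm
    · exact fun e => h.1.2.1 e.symm

/-- The inner product of the `x_i` lies over a cycle through the auxiliary last point. Conjugation
by the first transposition puts `i_1` in place of that point. -/
theorem proj_cycle {n : ℕ} (l : List ℕ) (hn : l.Nodup) (hl : ∀ i ∈ l, 1 ≤ i ∧ i ≤ n) :
    proj (n + 1) (cycle n l) = (l.map (pt n)).formPerm := by
  match l with
  | [] => simp [cycle]
  | [a] => simp [cycle]
  | a :: b :: l =>
    have ha := hl a (by simp)
    have hinj : ((a :: b :: l).map (pt n)).Nodup := by
      refine List.Nodup.map_on ?_ hn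
      intro i hi j hj h
      exact pt_injOn (hl i hi).1 (hl j hj).1 (hl j hj).2 h
    have hlast : Fin.last n ∉ (a :: b :: l).map (pt n) := by
      rw [List.mem_map]
      rintro ⟨i, hi, h⟩
      exact pt_ne_last (hl i hi).1 (hl i hi).2 h
    have h₁ : proj (n + 1) (((b :: l).reverse.map (x n)).prod) =
        (Fin.last n :: (b :: l).map (pt n)).formPerm := by
      rw [← prod_swap_eq_formPerm, map_list_prod, List.map_map, ← List.map_reverse, List.map_map]
      · congr 1
        refine List.map_congr_left fun i hi => ?_
        have := hl i (List.mem_cons_of_mem _ (List.mem_reverse.1 hi))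
        exact proj_x this.1 this.2
      · rw [List.nodup_cons]
        rw [List.map_cons, List.nodup_cons] at hinj
        rw [List.map_cons, List.mem_cons, not_or] at hlast
        exact ⟨hlast.2, hinj.2⟩
    rw [cycle, map_mul, map_mul, h₁, proj_x ha.1 ha.2, swap_formPerm_swap]
    · rfl
    · simp
    · rw [List.map_cons, List.nodup_cons] at hinj
      rw [List.map_cons, List.mem_cons, not_or] at hlast
      rw [List.nodup_cons, List.nodup_cons, List.mem_cons, not_or]
      exact ⟨⟨fun e => hlast.1 e.symm, hinj.1⟩, hlast.2, hinj.2⟩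
    · simp

/-- The bound on the moved points is part of the induction because it makes the first block disjoint
from the later ones, so that cycle types add. -/
theorem proj_blockCycles {n : ℕ} (o : ℕ) (ls : List ℕ) (hls : ∀ l ∈ ls, 1 ≤ l)
    (h : o + (ls.map (· + 1)).sum ≤ n) :
    (proj (n + 1) (blockCycles n o ls)).cycleType = ((ls.map (· + 1) : List ℕ) : Multiset ℕ) ∧
    ∀ y : Fin (n + 1), proj (n + 1) (blockCycles n o ls) y ≠ y →
      o ≤ y.val ∧ y.val < o + (ls.map (· + 1)).sum := by
  induction ls generalizing o with
  | nil => simp [blockCycles]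
  | cons a ls ih =>
    simp only [List.map_cons, List.sum_cons] at h ⊢
    obtain ⟨ih₁, ih₂⟩ := ih (o + a + 1) (fun l hl => hls l (List.mem_cons_of_mem _ hl)) (by omega)
    have ha := hls a (by simp)
    have hr : ∀ i ∈ List.range' (o + 1) (a + 1), 1 ≤ i ∧ i ≤ n := by
      intro i hi
      rw [List.mem_range'_1] at hi
      omega
    have hc := proj_cycle (n := n) (List.range' (o + 1) (a + 1)) List.nodup_range' hr
    have hinj : ((List.range' (o + 1) (a + 1)).map (pt n)).Nodup := by
      refine List.Nodup.map_on ?_ List.nodup_range'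
      intro i hi j hj h
      exact pt_injOn (hr i hi).1 (hr j hj).1 (hr j hj).2 h
    have hsupp : ∀ y : Fin (n + 1), proj (n + 1) (cycle n (List.range' (o + 1) (a + 1))) y ≠ y →
        o ≤ y.val ∧ y.val < o + a + 1 := by
      intro y hy
      rw [hc] at hy
      obtain ⟨i, hi, rfl⟩ := List.mem_map.1 (List.mem_of_formPerm_apply_ne hy)
      rw [List.mem_range'_1] at hi
      simp only [pt]
      omega
    have hd : Perm.Disjoint (proj (n + 1) (cycle n (List.range' (o + 1) (a + 1))))
        (proj (n + 1) (blockCycles n (o + a + 1) ls)) := by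
      intro y
      by_contra hy
      rw [not_or] at hy
      have h₁ := hsupp y hy.1
      have h₂ := ih₂ y hy.2
      omega
    rw [blockCycles, map_mul]
    constructor
    · rw [hd.cycleType_mul, ih₁, hc, (List.isCycle_formPerm hinj (by simp; omega)).cycleType,
        List.support_formPerm_of_nodup _ hinj, List.toFinset_card_of_nodup hinj]
      · simp
      · intro y hy
        have := congrArg List.length hy
        simp at this
        omega
    · intro y hy
      by_cases hy' : proj (n + 1) (blockCycles n (o + a + 1) ls) y = y
      · rw [Perm.mul_apply, hy'] at hy
        have := hsupp y hy
        omega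
      · have := ih₂ y hy'
        omega

/-! ### Even split classes -/

namespace EvenPartition

/-- The cycle type `(λ_1 + 1, λ_2 + 1, …)` with modified cycle type `λ`. -/
def cyc (la : EvenPartition) : Multiset ℕ := la.2.1.parts.map (· + 1)

theorem coe_parts (la : EvenPartition) : (la.parts : Multiset ℕ) = la.2.1.parts :=
  Multiset.sort_eq _ _

theorem mem_parts {la : EvenPartition} {i : ℕ} : i ∈ la.parts ↔ i ∈ la.2.1.parts := by
  rw [← coe_parts, Multiset.mem_coe]

theorem coe_map_parts (la : EvenPartition) :
    ((la.parts.map (· + 1) : List ℕ) : Multiset ℕ) = la.cyc := by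
  rw [← Multiset.map_coe, coe_parts, cyc]

theorem sum_cyc (la : EvenPartition) : la.cyc.sum = la.size + la.length := by
  simp [cyc, Multiset.sum_map_add, size, length, la.2.1.parts_sum]

theorem sum_map_parts (la : EvenPartition) :
    (la.parts.map (· + 1)).sum = la.size + la.length := by
  rw [← sum_cyc, ← coe_map_parts, Multiset.sum_coe]

theorem odd_of_mem_cyc {la : EvenPartition} {i : ℕ} (hi : i ∈ la.cyc) : Odd i := by
  obtain ⟨j, hj, rfl⟩ := Multiset.mem_map.1 hi
  exact (la.2.2 j hj).add_one

theorem cyc_injective : Function.Injective cyc := by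
  rintro ⟨m, ⟨⟨p, hp, rfl⟩, hpe⟩⟩ ⟨m', ⟨⟨q, hq, rfl⟩, hqe⟩⟩ h
  have : p = q := Multiset.map_injective (add_left_injective 1) h
  subst this
  rfl

theorem exists_cyc_eq {s : Multiset ℕ} (h : ∀ i ∈ s, Odd i ∧ 2 ≤ i) :
    ∃ la : EvenPartition, la.cyc = s := by
  refine ⟨⟨_, ⟨⟨s.map (· - 1), ?_, rfl⟩, ?_⟩⟩, ?_⟩
  · intro i hi
    obtain ⟨j, hj, rfl⟩ := Multiset.mem_map.1 hi
    have := (h j hj).2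
    omega
  · intro i hi
    obtain ⟨j, hj, rfl⟩ := Multiset.mem_map.1 hi
    exact (h j hj).1.tsub_odd odd_one
  · simp only [cyc, Multiset.map_map, Function.comp_apply]
    conv_rhs => rw [← Multiset.map_id' s]
    refine Multiset.map_congr rfl fun i hi => ?_
    have := (h i hi).2
    omega

end EvenPartition

theorem odd_orderOf {n : ℕ} {σ : Perm (Fin n)} (h : ∀ i ∈ σ.cycleType, Odd i) :
    Odd (orderOf σ) := by
  rw [← Perm.lcm_cycleType]
  generalize σ.cycleType = s at h
  induction s using Multiset.induction_on with
  | empty => simp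
  | cons a s ih =>
    rw [Multiset.lcm_cons]
    have h₁ := h a (by simp)
    have h₂ := ih fun i hi => h i (Multiset.mem_cons_of_mem hi)
    exact (h₁.mul h₂).of_dvd_nat (Nat.lcm_dvd_mul _ _)

theorem sign_eq_one {n : ℕ} {σ : Perm (Fin n)} (h : ∀ i ∈ σ.cycleType, Odd i) :
    Perm.sign σ = 1 := by
  rw [Perm.sign_of_cycleType']
  refine Multiset.prod_eq_one fun u hu => ?_
  obtain ⟨i, hi, rfl⟩ := Multiset.mem_map.1 hu
  rw [(h i hi).neg_one_pow, neg_neg]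

theorem cycleType_tPart {n : ℕ} {la : EvenPartition} (h : la.size + la.length ≤ n) :
    (proj (n + 1) (tPart n la)).cycleType = la.cyc ∧
      ∀ y : Fin (n + 1), la.size + la.length ≤ y.val → proj (n + 1) (tPart n la) y = y := by
  obtain ⟨h₁, h₂⟩ := proj_blockCycles (n := n) 0 la.parts
    (fun l hl => la.2.1.parts_pos (EvenPartition.mem_parts.1 hl))
    (by rw [la.sum_map_parts]; omega)
  rw [la.coe_map_parts] at h₁
  refine ⟨h₁, fun y hy => ?_⟩
  by_contra hc
  have := h₂ y hc
  rw [la.sum_map_parts] at this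
  omega

theorem exists_incl_eq_tPart {n : ℕ} {la : EvenPartition} (h : la.size + la.length ≤ n) :
    ∃ g : Cover n, incl n g = tPart n la :=
  mem_range_incl ((cycleType_tPart h).2 _ (by simpa using h))

/-- The element `t_λ` of the cover of `S_n` (for `|λ| + ℓ(λ) ≤ n`). -/
def tLift (n : ℕ) (la : EvenPartition) : Cover n :=
  if h : la.size + la.length ≤ n then (exists_incl_eq_tPart h).choose else 1

theorem incl_tLift {n : ℕ} {la : EvenPartition} (h : la.size + la.length ≤ n) :
    incl n (tLift n la) = tPart n la := by
  rw [tLift, dif_pos h]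
  exact (exists_incl_eq_tPart h).choose_spec

theorem cycleType_tLift {n : ℕ} {la : EvenPartition} (h : la.size + la.length ≤ n) :
    (proj n (tLift n la)).cycleType = la.cyc := by
  rw [← (cycleType_tPart h).1, ← incl_tLift h, incl_eq_inclTo, proj_inclTo,
    Perm.cycleType_extendDomain]

theorem proj_tLift_of_le {n : ℕ} {la : EvenPartition} (h : la.size + la.length ≤ n) (y : Fin n)
    (hy : la.size + la.length ≤ y.val) : proj n (tLift n la) y = y := by
  have h₁ := (cycleType_tPart h).2 y.castSucc hy
  rw [← incl_tLift h] at h₁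
  have h₂ : proj (n + 1) (incl n (tLift n la)) y.castSucc = (proj n (tLift n la) y).castSucc :=
    proj_inclTo_castLE (Nat.le_succ n) _ y
  exact Fin.castSucc_injective _ (h₂.symm.trans h₁)

theorem mem_D {n : ℕ} {la : EvenPartition} {g : Cover n} :
    g ∈ D n la ↔ la.size + la.length ≤ n ∧ IsConj (tLift n la) g := by
  constructor
  · rintro ⟨h, k, hk, hg⟩
    rw [← incl_tLift h] at hk
    rw [← incl_injective n hk]
    exact ⟨h, hg⟩
  · rintro ⟨h, hg⟩
    exact ⟨h, _, incl_tLift h, hg⟩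

theorem tLift_mem_D {n : ℕ} {la : EvenPartition} (h : la.size + la.length ≤ n) :
    tLift n la ∈ D n la := mem_D.2 ⟨h, IsConj.refl _⟩

theorem sign_tLift {n : ℕ} {la : EvenPartition} (h : la.size + la.length ≤ n) :
    Perm.sign (proj n (tLift n la)) = 1 :=
  sign_eq_one fun i hi => EvenPartition.odd_of_mem_cyc (by rwa [cycleType_tLift h] at hi)

/-- The definition of `t_λ` uses the auxiliary point of `S_{n+1}`, so its independence of `n` needs
proof. Conjugation by `t_{n+1}` carries one version to the other, and acts trivially because `t_λ`
is even and moves neither of the two points exchanged. -/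
theorem incl_tLift_succ {n : ℕ} {la : EvenPartition} (h : la.size + la.length ≤ n) :
    incl n (tLift n la) = tLift (n + 1) la := by
  apply incl_injective
  rw [incl_tLift (by omega : la.size + la.length ≤ n + 1)]
  have h₁ : conjIncl (n + 1) (tPart n la) = tPart (n + 1) la :=
    conjIncl_blockCycles 0 la.parts (fun l hl => la.2.2 l (EvenPartition.mem_parts.1 hl))
      (by rw [la.sum_map_parts]; omega)
  rw [← h₁, ← incl_tLift h, conjIncl_apply, eq_mul_inv_iff_mul_eq]
  rcases Nat.eq_zero_or_pos n with rfl | hn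
  · have : proj 0 (tLift 0 la) = 1 := Subsingleton.elim _ _
    rcases proj_eq_one this with h | h
    · simp [h]
    · simp [h, (commute_z _).eq]
  refine ((commute_of_disjoint ?_ ?_).eq).symm
  · intro y
    rw [proj_t (by omega) (by omega)]
    by_cases hy : y.val < n
    · left
      apply swap_apply_of_ne_of_ne <;>
      · rw [Ne, Fin.ext_iff]
        simp only
        omega
    · right
      rw [incl_eq_inclTo n, incl_inclTo]
      exact proj_inclTo_of_le _ _ _ (not_lt.1 hy)
  · rw [incl_eq_inclTo n, incl_inclTo, proj_inclTo, Perm.sign_extendDomain, sign_tLift h]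

theorem inclTo_tLift {n N : ℕ} (hN : n ≤ N) {la : EvenPartition} (h : la.size + la.length ≤ n) :
    inclTo hN (tLift n la) = tLift N la := by
  induction N, hN using Nat.le_induction with
  | base => exact inclTo_self _ _
  | succ N hN ih => rw [← incl_inclTo hN, ih, incl_tLift_succ (by omega)]

/-! ### The classes `D_λ(n)`: cycle types, signs and behaviour under inclusion -/

theorem isConj_or_of_cycleType_eq {n : ℕ} {g h : Cover n}
    (hgh : (proj n g).cycleType = (proj n h).cycleType) : IsConj g h ∨ IsConj g (z n * h) := by
  obtain ⟨σ, hσ⟩ := isConj_iff.1 (Perm.isConj_of_cycleType_eq hgh)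
  have : proj n (lift σ * g * (lift σ)⁻¹) = proj n h := by simp [hσ]
  rcases eq_or_eq_z_mul this with e | e
  · exact Or.inl (isConj_iff.2 ⟨_, e⟩)
  · exact Or.inr (isConj_iff.2 ⟨_, e⟩)

theorem cycleType_of_isConj {n : ℕ} {g h : Cover n} (hgh : IsConj g h) :
    (proj n g).cycleType = (proj n h).cycleType :=
  Perm.isConj_iff_cycleType_eq.1 ((proj n).map_isConj hgh)

theorem cycleType_of_mem_D {n : ℕ} {la : EvenPartition} {g : Cover n} (hg : g ∈ D n la) :
    (proj n g).cycleType = la.cyc := by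
  obtain ⟨h, hg⟩ := mem_D.1 hg
  rw [← cycleType_of_isConj hg, cycleType_tLift h]

theorem fits_of_cycleType {n : ℕ} {la : EvenPartition} {σ : Perm (Fin n)}
    (h : σ.cycleType = la.cyc) : la.size + la.length ≤ n := by
  rw [← la.sum_cyc, ← h]
  simpa using Perm.sum_cycleType_le σ

theorem mem_D_or {n : ℕ} {la : EvenPartition} {g : Cover n} (h : (proj n g).cycleType = la.cyc) :
    g ∈ D n la ∨ z n * g ∈ D n la := by
  have hf := fits_of_cycleType h
  rw [mem_D, mem_D, and_iff_right hf, and_iff_right hf]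
  exact isConj_or_of_cycleType_eq ((cycleType_tLift hf).trans h.symm)

theorem z_mul_notMem_D {n : ℕ} {la : EvenPartition} {g : Cover n} (hg : g ∈ D n la) :
    z n * g ∉ D n la := by
  intro hz
  refine not_isConj_z_mul (g := g) (odd_orderOf fun i hi => ?_)
    ((mem_D.1 hg).2.symm.trans (mem_D.1 hz).2)
  rw [cycleType_of_mem_D hg] at hi
  exact EvenPartition.odd_of_mem_cyc hi

theorem conj_mem_D {n : ℕ} {la : EvenPartition} {g : Cover n} (w : Cover n) :
    w * g * w⁻¹ ∈ D n la ↔ g ∈ D n la := by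
  rw [mem_D, mem_D]
  have : IsConj g (w * g * w⁻¹) := isConj_iff.2 ⟨w, rfl⟩
  exact and_congr_right fun _ => ⟨fun h => h.trans this.symm, fun h => h.trans this⟩

theorem eq_of_mem_D {n : ℕ} {la mu : EvenPartition} {g : Cover n} (h₁ : g ∈ D n la)
    (h₂ : g ∈ D n mu) : la = mu :=
  EvenPartition.cyc_injective ((cycleType_of_mem_D h₁).symm.trans (cycleType_of_mem_D h₂))

/-- No new elements of the smaller cover join the class: the cycle type puts `g` or `zg` in `D n
la`, and the second case would put both `inclTo hN g` and its `z`-multiple in `D N la`. -/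
theorem inclTo_mem_D {n N : ℕ} (hN : n ≤ N) {la : EvenPartition} {g : Cover n} :
    inclTo hN g ∈ D N la ↔ g ∈ D n la := by
  have key : ∀ g : Cover n, g ∈ D n la → inclTo hN g ∈ D N la := by
    intro g hg
    obtain ⟨h, hg⟩ := mem_D.1 hg
    rw [mem_D, ← inclTo_tLift hN h]
    exact ⟨h.trans hN, (inclTo hN).map_isConj hg⟩
  refine ⟨fun h => ?_, key g⟩
  have hc := cycleType_of_mem_D h
  rw [proj_inclTo, Perm.cycleType_extendDomain] at hc
  rcases mem_D_or hc with h' | h'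
  · exact h'
  · have := key _ h'
    rw [map_mul, inclTo_z] at this
    exact absurd this (z_mul_notMem_D h)

theorem exists_mem_D_or_isConj {n : ℕ} (g : Cover n) (hs : Perm.sign (proj n g) = 1) :
    (∃ la, g ∈ D n la ∨ z n * g ∈ D n la) ∨ IsConj g (z n * g) := by
  by_cases h : ∃ m ∈ (proj n g).cycleType, Even m
  · obtain ⟨m, hm, he⟩ := h
    exact Or.inr (isConj_z_mul hs hm he)
  · left
    push Not at h
    obtain ⟨la, hla⟩ := EvenPartition.exists_cyc_eq (s := (proj n g).cycleType)
      fun i hi => ⟨Nat.not_even_iff_odd.1 (h i hi), Perm.two_le_of_mem_cycleType hi⟩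
    exact ⟨la, mem_D_or hla.symm⟩

/-! ### Coefficients in the spin group algebra -/

theorem quotMap_surjective (n : ℕ) : Function.Surjective (quotMap n) :=
  RingQuot.mkRingHom_surjective _

theorem toSpin_apply (n : ℕ) (g : Cover n) :
    toSpin n g = quotMap n (MonoidAlgebra.of ℤ (Cover n) g) := rfl

@[simp] theorem toSpin_z (n : ℕ) : toSpin n (z n) = -1 := by
  have : quotMap n (MonoidAlgebra.of ℤ (Cover n) (z n) + 1) = quotMap n 0 :=
    RingQuot.mkRingHom_rel ⟨rfl, rfl⟩
  rw [map_add, map_one, map_zero] at this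
  exact eq_neg_of_add_eq_zero_left this

theorem toSpin_z_mul {n : ℕ} (g : Cover n) : toSpin n (z n * g) = -toSpin n g := by
  rw [map_mul, toSpin_z, neg_one_mul]

theorem commute_of_z {n : ℕ} (a : MonoidAlgebra ℤ (Cover n)) :
    Commute (MonoidAlgebra.of ℤ (Cover n) (z n)) a := by
  induction a using MonoidAlgebra.induction_on with
  | of g =>
    rw [commute_iff_eq, ← map_mul, ← map_mul, (commute_z g).eq]
  | add a b ha hb => exact ha.add_right hb
  | smul r a ha => exact ha.smul_right r

/-- The congruence of elements of the group ring with the same product with `1 - z`. -/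
def antiCon (n : ℕ) : RingCon (MonoidAlgebra ℤ (Cover n)) where
  r a b := (1 - MonoidAlgebra.of ℤ (Cover n) (z n)) * a =
    (1 - MonoidAlgebra.of ℤ (Cover n) (z n)) * b
  iseqv := ⟨fun _ => rfl, fun h => h.symm, fun h₁ h₂ => h₁.trans h₂⟩
  add' h₁ h₂ := by
    simp only [mul_add] at *
    rw [h₁, h₂]
  mul' {a b c d} h₁ h₂ := by
    have hc : ∀ x : MonoidAlgebra ℤ (Cover n),
        Commute (1 - MonoidAlgebra.of ℤ (Cover n) (z n)) x :=
      fun x => (Commute.one_left x).sub_left (commute_of_z x)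
    change _ * (a * c) = _ * (b * d)
    rw [← mul_assoc, h₁, (hc b).eq, mul_assoc, h₂, ← mul_assoc, ← (hc b).eq, mul_assoc]

/-- Since `(1 - z)(1 + z) = 0`, multiplication by the central element `1 - z` factors through the
quotient by `z + 1`. This makes coefficients on the spin algebra well defined. -/
theorem antiCon_of_quotMap_eq {n : ℕ} {a b : MonoidAlgebra ℤ (Cover n)}
    (h : quotMap n a = quotMap n b) :
    (1 - MonoidAlgebra.of ℤ (Cover n) (z n)) * a =
      (1 - MonoidAlgebra.of ℤ (Cover n) (z n)) * b := by
  have hw : ∀ ⦃a b : MonoidAlgebra ℤ (Cover n)⦄,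
      (a = MonoidAlgebra.of ℤ (Cover n) (z n) + 1 ∧ b = 0) →
        (antiCon n).mk' a = (antiCon n).mk' b := by
    rintro _ _ ⟨rfl, rfl⟩
    refine (RingCon.eq _).2 ?_
    change _ * _ = _ * _
    rw [mul_zero, sub_mul, one_mul, mul_add, mul_one, ← map_mul, z_mul_z, map_one]
    abel
  let L : SpinAlg n →+* (antiCon n).Quotient := RingQuot.lift ⟨(antiCon n).mk', hw⟩
  have hL : ∀ a, L (quotMap n a) = (antiCon n).mk' a :=
    fun a => RingQuot.lift_mkRingHom_apply _ hw a
  have h₁ := congrArg L h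
  rw [hL, hL] at h₁
  exact (RingCon.eq _).1 h₁

/-- The additive map `a ↦ a(g) - a(zg)` on the group ring. -/
def preCoef (n : ℕ) (g : Cover n) : MonoidAlgebra ℤ (Cover n) →+ ℤ where
  toFun a := ((1 - MonoidAlgebra.of ℤ (Cover n) (z n)) * a).coeff g
  map_zero' := by simp
  map_add' a b := by rw [mul_add]; rfl

/-- The coefficient of `g` of an element of the spin group algebra. -/
def spinCoef (n : ℕ) (g : Cover n) : SpinAlg n →+ ℤ :=
  AddMonoidHom.liftOfSurjective (quotMap n : MonoidAlgebra ℤ (Cover n) →+ SpinAlg n)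
    (quotMap_surjective n) ⟨preCoef n g, fun a ha => by
      have : quotMap n a = quotMap n 0 := by rw [map_zero]; exact ha
      rw [AddMonoidHom.mem_ker]
      change ((1 - MonoidAlgebra.of ℤ (Cover n) (z n)) * a).coeff g = 0
      rw [antiCon_of_quotMap_eq this, mul_zero]
      rfl⟩

theorem spinCoef_quotMap {n : ℕ} (g : Cover n) (a : MonoidAlgebra ℤ (Cover n)) :
    spinCoef n g (quotMap n a) = preCoef n g a :=
  AddMonoidHom.liftOfRightInverse_comp_apply _ _ _ _ a

theorem spinCoef_toSpin {n : ℕ} (g h : Cover n) :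
    spinCoef n g (toSpin n h) = (if h = g then 1 else 0) - (if h = z n * g then 1 else 0) := by
  rw [toSpin_apply, spinCoef_quotMap]
  change ((1 - MonoidAlgebra.of ℤ (Cover n) (z n)) * MonoidAlgebra.of ℤ (Cover n) h).coeff g = _
  rw [sub_mul, one_mul, ← map_mul]
  change (MonoidAlgebra.of ℤ (Cover n) h).coeff g -
    (MonoidAlgebra.of ℤ (Cover n) (z n * h)).coeff g = _
  simp only [MonoidAlgebra.of_apply, MonoidAlgebra.coeff_single, Finsupp.single_apply]
  congr 2
  rw [← mul_right_inj (z n), z_mul_cancel]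

theorem spin_induction {n : ℕ} {p : SpinAlg n → Prop} (h : ∀ g, p (toSpin n g))
    (hadd : ∀ x y, p x → p y → p (x + y)) (hneg : ∀ x, p x → p (-x)) (x : SpinAlg n) : p x := by
  have h0 : p 0 := by
    rw [← add_neg_cancel (toSpin n 1)]
    exact hadd _ _ (h 1) (hneg _ (h 1))
  obtain ⟨a, rfl⟩ := quotMap_surjective n x
  induction a using MonoidAlgebra.induction_on with
  | of g => exact h g
  | add a b ha hb => rw [map_add]; exact hadd _ _ ha hb
  | smul r a ha =>
    rw [map_zsmul]
    induction r using Int.induction_on with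
    | zero => rw [zero_smul]; exact h0
    | succ k ih => rw [add_smul, one_smul]; exact hadd _ _ ih ha
    | pred k ih => rw [sub_smul, one_smul, sub_eq_add_neg]; exact hadd _ _ ih (hneg _ ha)

/-- Choosing one lift of each permutation picks one of `g, zg` from each pair, and the other one is
its negative. -/
theorem eq_sum_spinCoef {n : ℕ} (x : SpinAlg n) :
    x = ∑ σ : Perm (Fin n), spinCoef n (lift σ) x • toSpin n (lift σ) := by
  induction x using spin_induction with
  | h g =>
    rw [Finset.sum_eq_single (proj n g)]
    · rw [spinCoef_toSpin]
      rcases eq_or_eq_z_mul (proj_lift (proj n g)).symm with e | e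
      · rw [if_pos e, if_neg fun h => z_mul_ne _ (h.symm.trans e), sub_zero, one_smul, ← e]
      · rw [if_neg fun h => z_mul_ne _ (e.symm.trans h), if_pos e, zero_sub, neg_one_smul,
          ← toSpin_z_mul, ← e]
    · intro σ _ hσ
      rw [spinCoef_toSpin, if_neg, if_neg, sub_self, zero_smul]
      · rintro rfl; simp at hσ
      · rintro rfl; simp at hσ
    · simp
  | hadd x y hx hy =>
    simp only [map_add, add_smul, Finset.sum_add_distrib]
    rw [← hx, ← hy]
  | hneg x hx =>
    simp only [map_neg, neg_smul, Finset.sum_neg_distrib]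
    rw [← hx]

theorem spin_ext {n : ℕ} {x y : SpinAlg n} (h : ∀ g, spinCoef n g x = spinCoef n g y) : x = y := by
  rw [eq_sum_spinCoef x, eq_sum_spinCoef y]
  simp only [h]

theorem spinCoef_z_mul {n : ℕ} (g : Cover n) (x : SpinAlg n) :
    spinCoef n (z n * g) x = -spinCoef n g x := by
  induction x using spin_induction with
  | h k => rw [spinCoef_toSpin, spinCoef_toSpin, z_mul_cancel, neg_sub]
  | hadd x y hx hy => rw [map_add, map_add, hx, hy, neg_add]
  | hneg x hx => rw [map_neg, map_neg, hx]

theorem spinCoef_conj {n : ℕ} (w g : Cover n) (x : SpinAlg n) :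
    spinCoef n g (toSpin n w * x * toSpin n w⁻¹) = spinCoef n (w⁻¹ * g * w) x := by
  induction x using spin_induction with
  | h k =>
    rw [← map_mul, ← map_mul, spinCoef_toSpin, spinCoef_toSpin]
    congr 2
    · rw [mul_inv_eq_iff_eq_mul, ← eq_inv_mul_iff_mul_eq, mul_assoc]
    · rw [mul_inv_eq_iff_eq_mul, ← eq_inv_mul_iff_mul_eq, ← mul_assoc, ← mul_assoc w⁻¹,
        ← (commute_z w⁻¹).eq]
      simp only [mul_assoc]
  | hadd x y hx hy => rw [mul_add, add_mul, map_add, map_add, hx, hy]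
  | hneg x hx => rw [mul_neg, neg_mul, map_neg, map_neg, hx]

theorem spinCoef_eq_of_isConj {n : ℕ} {x : SpinAlg n} (hx : x ∈ evenCenter n) {g h : Cover n}
    (hgh : IsConj g h) : spinCoef n g x = spinCoef n h x := by
  obtain ⟨w, rfl⟩ := isConj_iff.1 hgh
  have hc := Subalgebra.mem_center_iff.1 hx.1 (toSpin n w)
  have h₁ := spinCoef_conj w (w * g * w⁻¹) x
  rw [hc, mul_assoc x, ← map_mul, mul_inv_cancel, map_one, mul_one] at h₁
  rw [h₁]
  congr 1
  group

theorem spinCoef_eq_zero_of_sign {n : ℕ} {x : SpinAlg n} (hx : x ∈ evenCenter n) {g : Cover n}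
    (hg : Perm.sign (proj n g) ≠ 1) : spinCoef n g x = 0 := by
  have hx' : x ∈ Submodule.span ℤ (toSpin n '' {g | parity n g = 1}) := hx.2
  clear hx
  induction hx' using Submodule.span_induction with
  | mem x hx =>
    obtain ⟨k, hk, rfl⟩ := hx
    rw [Set.mem_ofPred_eq, parity_eq_one_iff] at hk
    rw [spinCoef_toSpin, if_neg, if_neg, sub_self]
    · rintro rfl; exact hg (by simpa using hk)
    · rintro rfl; exact hg hk
  | zero => simp
  | add x y _ _ hx hy => rw [map_add, hx, hy, add_zero]
  | smul r x _ hx => rw [map_zsmul, hx, smul_zero]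

/-! ### The class sums as a basis of the even center -/

theorem dn_eq_sum {n : ℕ} (la : EvenPartition) [DecidablePred (· ∈ D n la)] :
    dn n la = ∑ g : Cover n with g ∈ D n la, toSpin n g := by
  rw [dn, finsum_mem_eq_finite_toFinset_sum _ (Set.toFinite _), map_sum]
  refine Finset.sum_congr ?_ fun g _ => rfl
  ext g; simp

theorem dn_eq_zero {n : ℕ} {la : EvenPartition} (h : n < la.size + la.length) : dn n la = 0 := by
  classical
  rw [dn_eq_sum, Finset.sum_eq_zero]
  intro g hg
  have := (mem_D.1 (Finset.mem_filter.1 hg).2).1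
  omega

theorem spinCoef_dn {n : ℕ} (la : EvenPartition) (g : Cover n) [DecidablePred (· ∈ D n la)] :
    spinCoef n g (dn n la) =
      (if g ∈ D n la then 1 else 0) - (if z n * g ∈ D n la then 1 else 0) := by
  rw [dn_eq_sum, map_sum]
  simp only [spinCoef_toSpin, Finset.sum_sub_distrib, Finset.sum_ite_eq', Finset.mem_filter,
    Finset.mem_univ, true_and]

theorem toSpin_mul_dn {n : ℕ} (la : EvenPartition) (g : Cover n) :
    toSpin n g * dn n la = dn n la * toSpin n g := by
  classical
  rw [dn_eq_sum, Finset.mul_sum, Finset.sum_mul]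
  simp only [← map_mul]
  refine Finset.sum_equiv (MulAut.conj g).toEquiv (fun k => ?_) fun k _ => ?_
  · simp [conj_mem_D]
  · simp

theorem dn_mem_evenCenter {n : ℕ} (la : EvenPartition) : dn n la ∈ evenCenter n := by
  classical
  refine ⟨Subalgebra.mem_center_iff.2 fun x => ?_, ?_⟩
  · induction x using spin_induction with
    | h g => exact toSpin_mul_dn la g
    | hadd x y hx hy => rw [add_mul, mul_add, hx, hy]
    | hneg x hx => rw [neg_mul, mul_neg, hx]
  · change dn n la ∈ Submodule.span ℤ (toSpin n '' {g | parity n g = 1})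
    rw [dn_eq_sum]
    refine Submodule.sum_mem _ fun g hg => Submodule.subset_span ⟨g, ?_, rfl⟩
    rw [Set.mem_ofPred_eq, parity_eq_one_iff]
    refine sign_eq_one fun i hi => ?_
    rw [cycleType_of_mem_D (Finset.mem_filter.1 hg).2] at hi
    exact EvenPartition.odd_of_mem_cyc hi

/-- The coefficients at the `t_μ` are dual to the class sums: `t_μ` lies in no other class `D_λ(n)`,
and in no `z`-multiple of such a class. -/
theorem spinCoef_tLift_dn {n : ℕ} {la mu : EvenPartition} (h : mu.size + mu.length ≤ n) :
    spinCoef n (tLift n mu) (dn n la) = if la = mu then 1 else 0 := by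
  classical
  rw [spinCoef_dn]
  split_ifs with h₁ h₂ h₃ h₃ h₄ h₅ h₅
  · exact absurd h₂ (z_mul_notMem_D h₁)
  · exact absurd h₂ (z_mul_notMem_D h₁)
  · rfl
  · exact absurd (eq_of_mem_D h₁ (tLift_mem_D h)) h₃
  · subst h₅; exact absurd (tLift_mem_D h) h₁
  · have := cycleType_of_mem_D h₄
    rw [map_mul, proj_z, one_mul, cycleType_tLift h] at this
    exact absurd (EvenPartition.cyc_injective this).symm h₅
  · subst h₅; exact absurd (tLift_mem_D h) h₁
  · rfl

/-- Odd elements have coefficient zero. An even `g` is either conjugate to some `t_λ`, possibly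
after multiplication by `z`, or conjugate to `zg`. In the last case its coefficient equals its own
negative. -/
theorem evenCenter_ext {n : ℕ} {x y : SpinAlg n} (hx : x ∈ evenCenter n) (hy : y ∈ evenCenter n)
    (h : ∀ la : EvenPartition, la.size + la.length ≤ n →
      spinCoef n (tLift n la) x = spinCoef n (tLift n la) y) : x = y := by
  have key : ∀ (la : EvenPartition) (g : Cover n), g ∈ D n la →
      spinCoef n g x = spinCoef n g y := by
    intro la g hg
    obtain ⟨h₁, h₂⟩ := mem_D.1 hg
    rw [← spinCoef_eq_of_isConj hx h₂, ← spinCoef_eq_of_isConj hy h₂, h la h₁]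
  refine spin_ext fun g => ?_
  by_cases hs : Perm.sign (proj n g) = 1
  · rcases exists_mem_D_or_isConj g hs with ⟨la, hla | hla⟩ | hg
    · exact key la g hla
    · have := key la _ hla
      rwa [spinCoef_z_mul, spinCoef_z_mul, neg_inj] at this
    · have h₁ := spinCoef_eq_of_isConj hx hg
      have h₂ := spinCoef_eq_of_isConj hy hg
      rw [spinCoef_z_mul] at h₁ h₂
      omega
  · rw [spinCoef_eq_zero_of_sign hx hs, spinCoef_eq_zero_of_sign hy hs]

theorem spinCoef_tLift_sum {n : ℕ} (a : EvenPartition → ℤ) {mu : EvenPartition}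
    (h : mu.size + mu.length ≤ n) :
    spinCoef n (tLift n mu) (∑ nu ∈ EvenPartition.fits n, a nu • dn n nu) = a mu := by
  rw [map_sum, Finset.sum_eq_single mu]
  · rw [map_zsmul, spinCoef_tLift_dn h, if_pos rfl, smul_eq_mul, mul_one]
  · intro b _ hb
    rw [map_zsmul, spinCoef_tLift_dn h, if_neg hb, smul_zero]
  · intro h'; exact absurd (EvenPartition.mem_fits.2 h) h'

theorem evenCenter_eq_sum {n : ℕ} {x : SpinAlg n} (hx : x ∈ evenCenter n) :
    x = ∑ nu ∈ EvenPartition.fits n, spinCoef n (tLift n nu) x • dn n nu := by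
  refine evenCenter_ext hx ?_ fun la h => ?_
  · exact Subalgebra.sum_mem _ fun nu _ => Subalgebra.smul_mem _ (dn_mem_evenCenter nu) _
  · rw [spinCoef_tLift_sum _ h]

/-! ### Structure constants as signed counts of pairs -/

theorem existsUnique_structureConstants (n : ℕ) (la mu : EvenPartition) :
    ∃! a : EvenPartition → ℤ, IsStructureConstants n la mu a := by
  have hm : dn n la * dn n mu ∈ evenCenter n :=
    Subalgebra.mul_mem _ (dn_mem_evenCenter la) (dn_mem_evenCenter mu)
  refine ⟨fun nu => if nu.size + nu.length ≤ n then spinCoef n (tLift n nu) (dn n la * dn n mu)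
    else 0, ⟨fun nu h => if_neg (not_le.2 h), ?_⟩, ?_⟩
  · nth_rewrite 1 [evenCenter_eq_sum hm]
    refine Finset.sum_congr rfl fun nu hnu => ?_
    dsimp only
    rw [if_pos (EvenPartition.mem_fits.1 hnu)]
  · rintro a ⟨h₁, h₂⟩
    funext nu
    split_ifs with h
    · rw [h₂, spinCoef_tLift_sum _ h]
    · exact h₁ nu (not_le.1 h)

theorem structConst_spec (n : ℕ) (la mu : EvenPartition) :
    IsStructureConstants n la mu (structConst n la mu) :=
  Classical.epsilon_spec (existsUnique_structureConstants n la mu).exists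

theorem structConst_eq {n : ℕ} {la mu nu : EvenPartition} (h : nu.size + nu.length ≤ n) :
    structConst n la mu nu = spinCoef n (tLift n nu) (dn n la * dn n mu) := by
  rw [(structConst_spec n la mu).2, spinCoef_tLift_sum _ h]

/-- The signed number of ways to write `k` as a product of `g` and `h`. -/
def signedEq {n : ℕ} (k g h : Cover n) : ℤ :=
  (if g * h = k then 1 else 0) - (if g * h = z n * k then 1 else 0)

theorem structConst_eq_sum {n : ℕ} {la mu nu : EvenPartition} (h : nu.size + nu.length ≤ n)
    [DecidablePred (· ∈ D n la)] [DecidablePred (· ∈ D n mu)] :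
    structConst n la mu nu =
      ∑ p : Cover n × Cover n with p.1 ∈ D n la ∧ p.2 ∈ D n mu,
        signedEq (tLift n nu) p.1 p.2 := by
  rw [structConst_eq h, dn_eq_sum, dn_eq_sum, Finset.sum_mul_sum, ← Finset.sum_product', map_sum,
    ← Finset.filter_product, Finset.univ_product_univ]
  refine Finset.sum_congr rfl fun p _ => ?_
  rw [← map_mul, spinCoef_toSpin, signedEq]

/-! ### Counting pairs by their supports -/

section Counting

open scoped Classical in
/-- The pairs in `D_λ(N) × D_μ(N)`. -/
def classPairs (N : ℕ) (la mu : EvenPartition) : Finset (Cover N × Cover N) :=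
  Finset.univ.filter fun p => p.1 ∈ D N la ∧ p.2 ∈ D N mu

theorem mem_classPairs {N : ℕ} {la mu : EvenPartition} {p : Cover N × Cover N} :
    p ∈ classPairs N la mu ↔ p.1 ∈ D N la ∧ p.2 ∈ D N mu := by
  simp [classPairs]

/-- The points `≥ m` moved by one of the elements of a pair. -/
def pairSupp {N : ℕ} (m : ℕ) (p : Cover N × Cover N) : Finset (Fin N) :=
  ((proj N p.1).support ∪ (proj N p.2).support).filter fun i => m ≤ i.val

theorem mem_pairSupp {N m : ℕ} {p : Cover N × Cover N} {i : Fin N} :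
    i ∈ pairSupp m p ↔ (proj N p.1 i ≠ i ∨ proj N p.2 i ≠ i) ∧ m ≤ i.val := by
  simp [pairSupp]

/-- The points `i` with `m ≤ i < n`. -/
def interval (N m n : ℕ) : Finset (Fin N) := Finset.univ.filter fun i => m ≤ i.val ∧ i.val < n

theorem mem_interval {N m n : ℕ} {i : Fin N} : i ∈ interval N m n ↔ m ≤ i.val ∧ i.val < n := by
  simp [interval]

theorem card_interval {N m n : ℕ} (h : n ≤ N) : (interval N m n).card = n - m := by
  rw [← Nat.card_Ico, ← Finset.card_map Fin.valEmbedding]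
  congr 1
  ext k
  simp only [Finset.mem_map, mem_interval, Fin.valEmbedding_apply, Finset.mem_Ico]
  exact ⟨fun ⟨i, hi, e⟩ => e ▸ hi, fun hk => ⟨⟨k, by omega⟩, hk, rfl⟩⟩

theorem signedEq_inclTo {n N : ℕ} (h : n ≤ N) (k g l : Cover n) :
    signedEq (inclTo h k) (inclTo h g) (inclTo h l) = signedEq k g l := by
  simp only [signedEq, ← inclTo_z h, ← map_mul, (inclTo_injective h).eq_iff]

theorem signedEq_conj {n : ℕ} (w k g l : Cover n) :
    signedEq (w * k * w⁻¹) (w * g * w⁻¹) (w * l * w⁻¹) = signedEq k g l := by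
  have h₁ : w * g * w⁻¹ * (w * l * w⁻¹) = w * (g * l) * w⁻¹ := by group
  have h₂ : z n * (w * k * w⁻¹) = w * (z n * k) * w⁻¹ := by
    rw [← mul_assoc, ← mul_assoc, (commute_z w).eq, mul_assoc w]
  simp only [signedEq, h₁, h₂, mul_left_inj, mul_right_inj]

/-- For all `n ≤ N` the pairs are now counted in the same group. They come from the cover of `S_n`
exactly when they move no point `≥ n`, so `n` enters only through the interval. -/
theorem structConst_eq_sum_inclTo {n N : ℕ} (h : n ≤ N) {la mu nu : EvenPartition}
    (hn : nu.size + nu.length ≤ n) :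
    structConst n la mu nu =
      ∑ p ∈ (classPairs N la mu).filter
        (fun p => pairSupp (nu.size + nu.length) p ⊆ interval N (nu.size + nu.length) n),
        signedEq (tLift N nu) p.1 p.2 := by
  classical
  rw [structConst_eq_sum hn]
  refine Finset.sum_bij (fun p _ => (inclTo h p.1, inclTo h p.2)) ?_ ?_ ?_ ?_
  · intro p hp
    rw [Finset.mem_filter] at hp
    rw [Finset.mem_filter, mem_classPairs]
    refine ⟨⟨(inclTo_mem_D h).2 hp.2.1, (inclTo_mem_D h).2 hp.2.2⟩, fun i hi => ?_⟩
    rw [mem_pairSupp] at hi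
    rw [mem_interval]
    refine ⟨hi.2, ?_⟩
    by_contra hc
    exact hi.1.elim (fun h' => h' (proj_inclTo_of_le h _ _ (not_lt.1 hc)))
      (fun h' => h' (proj_inclTo_of_le h _ _ (not_lt.1 hc)))
  · intro p _ q _ hpq
    rw [Prod.mk.injEq] at hpq
    exact Prod.ext (inclTo_injective h hpq.1) (inclTo_injective h hpq.2)
  · intro p hp
    rw [Finset.mem_filter, mem_classPairs] at hp
    have hfix : ∀ i : Fin N, n ≤ i.val → proj N p.1 i = i ∧ proj N p.2 i = i := by
      intro i hi
      by_contra hc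
      rw [not_and_or] at hc
      have := hp.2 (mem_pairSupp.2 ⟨hc, hn.trans hi⟩)
      rw [mem_interval] at this
      omega
    obtain ⟨g, hg⟩ := mem_range_inclTo h p.1 fun i hi => (hfix i hi).1
    obtain ⟨k, hk⟩ := mem_range_inclTo h p.2 fun i hi => (hfix i hi).2
    refine ⟨(g, k), ?_, Prod.ext hg hk⟩
    rw [Finset.mem_filter]
    exact ⟨Finset.mem_univ _, (inclTo_mem_D h).1 (hg ▸ hp.1.1), (inclTo_mem_D h).1 (hk ▸ hp.1.2)⟩
  · intro p _
    rw [← inclTo_tLift h hn, signedEq_inclTo]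

/-- The signed number of pairs with prescribed moved points outside the support of `t_ν`. -/
def suppCount (N : ℕ) (la mu nu : EvenPartition) (V : Finset (Fin N)) : ℤ :=
  ∑ p ∈ (classPairs N la mu).filter (fun p => pairSupp (nu.size + nu.length) p = V),
    signedEq (tLift N nu) p.1 p.2

theorem structConst_eq_sum_suppCount {n N : ℕ} (h : n ≤ N) {la mu nu : EvenPartition}
    (hn : nu.size + nu.length ≤ n) :
    structConst n la mu nu =
      ∑ V ∈ (interval N (nu.size + nu.length) n).powerset, suppCount N la mu nu V := by
  rw [structConst_eq_sum_inclTo h hn]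
  rw [← Finset.sum_fiberwise_of_maps_to (t := (interval N (nu.size + nu.length) n).powerset)
    (g := pairSupp (nu.size + nu.length))]
  · refine Finset.sum_congr rfl fun V hV => ?_
    rw [suppCount, Finset.filter_filter]
    refine Finset.sum_congr (Finset.filter_congr fun p _ => ?_) fun _ _ => rfl
    exact ⟨fun h => h.2, fun h => ⟨h ▸ Finset.mem_powerset.1 hV, h⟩⟩
  · intro p hp
    exact Finset.mem_powerset.2 (Finset.mem_filter.1 hp).2

/-- Conjugation by a lift of a permutation `σ` that fixes the first `m` points and carries `V` to
`V'` maps one set of pairs to the other. -/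
theorem suppCount_eq_of_card_eq {N : ℕ} {la mu nu : EvenPartition} (hn : nu.size + nu.length ≤ N)
    {V V' : Finset (Fin N)} (hV : ∀ i ∈ V, nu.size + nu.length ≤ i.val)
    (hV' : ∀ i ∈ V', nu.size + nu.length ≤ i.val) (hc : V.card = V'.card) :
    suppCount N la mu nu V = suppCount N la mu nu V' := by
  set m := nu.size + nu.length with hm
  have e : V ≃ V' := Finset.equivOfCardEq hc
  obtain ⟨σ, hσ⟩ := exists_perm_comp_eq
    (Sum.elim (fun i : {i : Fin N // i.val < m} => i.1) (fun i : V => i.1))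
    (Sum.elim (fun i : {i : Fin N // i.val < m} => i.1) (fun i : V => (e i).1))
    (Function.Injective.sumElim Subtype.val_injective Subtype.val_injective
      (fun i j h => by have := hV j j.2; rw [← h] at this; omega))
    (Function.Injective.sumElim Subtype.val_injective
      (Subtype.val_injective.comp e.injective)
      (fun i j h => by have := hV' _ (e j).2; rw [← h] at this; omega))
  have hσ₁ : ∀ i : Fin N, i.val < m → σ i = i := fun i hi => hσ (Sum.inl ⟨i, hi⟩)
  have hσ₂ : ∀ i (hi : i ∈ V), σ i = e ⟨i, hi⟩ := fun i hi => hσ (Sum.inr ⟨i, hi⟩)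
  have hσ₃ : ∀ i : Fin N, m ≤ (σ i).val ↔ m ≤ i.val := by
    intro i
    constructor
    · intro h
      by_contra hc
      rw [hσ₁ i (not_le.1 hc)] at h
      exact hc h
    · intro h
      by_contra hc
      have := σ.injective (hσ₁ _ (not_le.1 hc))
      rw [this] at hc
      exact hc h
  have hVmap : V.map σ.toEmbedding = V' := by
    refine Finset.eq_of_subset_of_card_le ?_ (by rw [Finset.card_map, hc])
    intro i hi
    obtain ⟨j, hj, rfl⟩ := Finset.mem_map.1 hi
    change σ j ∈ V'
    rw [hσ₂ j hj]
    exact (e _).2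
  set w := lift σ with hw
  have hps : ∀ p : Cover N × Cover N,
      pairSupp m (w * p.1 * w⁻¹, w * p.2 * w⁻¹) = (pairSupp m p).map σ.toEmbedding := by
    intro p
    ext i
    obtain ⟨i, rfl⟩ := σ.surjective i
    have h₁ : σ i ∈ (pairSupp m p).map σ.toEmbedding ↔ i ∈ pairSupp m p :=
      Finset.mem_map' σ.toEmbedding
    rw [h₁, mem_pairSupp, mem_pairSupp, hσ₃]
    simp [hw]
  -- The permutation `σ` may be odd, but `t_ν` is even, so disjointness of supports gives
  -- commutation without a sign.
  have hcomm : w * tLift N nu * w⁻¹ = tLift N nu := by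
    rw [mul_inv_eq_iff_eq_mul]
    refine (commute_of_disjoint (fun i => ?_) (sign_tLift hn)).eq
    rcases Nat.lt_or_ge i.val m with hi | hi
    · left; rw [hw, proj_lift]; exact hσ₁ i hi
    · right; exact proj_tLift_of_le hn i hi
  refine Finset.sum_equiv ((MulAut.conj w).toEquiv.prodCongr (MulAut.conj w).toEquiv) ?_ ?_
  · intro p
    rw [Finset.mem_filter, Finset.mem_filter, mem_classPairs, mem_classPairs]
    refine and_congr (and_congr (conj_mem_D w).symm (conj_mem_D w).symm) ?_
    change _ ↔ pairSupp m (w * p.1 * w⁻¹, w * p.2 * w⁻¹) = V'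
    rw [hps, ← hVmap]
    exact (Finset.map_injective σ.toEmbedding).eq_iff.symm
  · intro p _
    change _ = signedEq (tLift N nu) (w * p.1 * w⁻¹) (w * p.2 * w⁻¹)
    rw [← signedEq_conj w, hcomm]

theorem suppCount_eq_zero {N : ℕ} {la mu nu : EvenPartition} {V : Finset (Fin N)}
    (hV : la.size + la.length + (mu.size + mu.length) < V.card) :
    suppCount N la mu nu V = 0 := by
  rw [suppCount, Finset.filter_eq_empty_iff.2, Finset.sum_empty]
  rintro p hp rfl
  rw [mem_classPairs] at hp
  have h₁ : (proj N p.1).support.card = la.size + la.length := by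
    rw [← Perm.sum_cycleType, cycleType_of_mem_D hp.1, la.sum_cyc]
  have h₂ : (proj N p.2).support.card = mu.size + mu.length := by
    rw [← Perm.sum_cycleType, cycleType_of_mem_D hp.2, mu.sum_cyc]
  have h₃ := (Finset.card_filter_le ((proj N p.1).support ∪ (proj N p.2).support)
    fun i => nu.size + nu.length ≤ i.val).trans (Finset.card_union_le _ _)
  rw [h₁, h₂] at h₃
  exact absurd hV (not_lt.2 h₃)

/-- Grouping the subsets `V` of an `m`-element interval by cardinality `k` produces `m.choose k`.
The coefficients are computed in the ambient group for `n₀ + M`, so a priori they depend on `M`. -/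
theorem exists_binomial_coeffs (la mu nu : EvenPartition) (M : ℕ) :
    ∃ c : ℕ → ℤ,
      (∀ k ≤ M, la.size + la.length + (mu.size + mu.length) < k → c k = 0) ∧
      ∀ m ≤ M, structConst (nu.size + nu.length + m) la mu nu =
        ∑ k ∈ Finset.range (m + 1), (m.choose k : ℤ) * c k := by
  set n₀ := nu.size + nu.length with hn₀
  refine ⟨fun k => suppCount (n₀ + M) la mu nu (interval (n₀ + M) n₀ (n₀ + k)), ?_, ?_⟩
  · intro k hk h
    refine suppCount_eq_zero ?_
    rw [card_interval (by omega)]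
    omega
  · intro m hm
    rw [structConst_eq_sum_suppCount (N := n₀ + M) (by omega) (by omega)]
    have hc : (interval (n₀ + M) n₀ (n₀ + m)).card = m := by
      rw [card_interval (by omega)]; omega
    have := Finset.sum_powerset_apply_card
      (fun k => suppCount (n₀ + M) la mu nu (interval (n₀ + M) n₀ (n₀ + k)))
      (x := interval (n₀ + M) n₀ (n₀ + m))
    rw [hc] at this
    simp only [nsmul_eq_mul] at this
    rw [← this]
    refine Finset.sum_congr rfl fun V hV => ?_
    rw [Finset.mem_powerset] at hV
    have hV' := Finset.card_le_card hV
    rw [hc] at hV'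
    refine suppCount_eq_of_card_eq (by omega) (fun i hi => (mem_interval.1 (hV hi)).1)
      (fun i hi => (mem_interval.1 hi).1) ?_
    rw [card_interval (by omega)]
    omega

end Counting

/-- The system is triangular with diagonal entries `m.choose m = 1`. -/
theorem binomial_coeffs_unique {c c' : ℕ → ℤ} {M : ℕ}
    (h : ∀ m ≤ M, ∑ k ∈ Finset.range (m + 1), (m.choose k : ℤ) * c k =
      ∑ k ∈ Finset.range (m + 1), (m.choose k : ℤ) * c' k) : ∀ k ≤ M, c k = c' k := by
  intro k
  induction k using Nat.strong_induction_on with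
  | _ k ih =>
    intro hk
    have := h k hk
    rw [Finset.sum_range_succ, Finset.sum_range_succ, Nat.choose_self, Nat.cast_one, one_mul,
      one_mul] at this
    rw [Finset.sum_congr rfl fun j hj => by
      rw [ih j (Finset.mem_range.1 hj) ((Finset.mem_range.1 hj).le.trans hk)]] at this
    exact add_left_cancel this

/-- By uniqueness `c M k = c k k` for `k ≤ M`, so the diagonal gives coefficients independent of the
ambient group. -/
theorem exists_binomial_coeffs_all (la mu nu : EvenPartition) :
    ∃ (K : ℕ) (c : ℕ → ℤ),
      ∀ m, structConst (nu.size + nu.length + m) la mu nu =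
        ∑ k ∈ Finset.range (K + 1), (m.choose k : ℤ) * c k := by
  choose c h₁ h₂ using exists_binomial_coeffs la mu nu
  set K := la.size + la.length + (mu.size + mu.length) with hK
  have huniq : ∀ M k, k ≤ M → c M k = c k k := by
    intro M k hk
    exact binomial_coeffs_unique (M := k)
      (fun m hm => by rw [← h₂ M m (hm.trans hk), ← h₂ k m hm]) k le_rfl
  refine ⟨K, fun k => c k k, fun m => ?_⟩
  rw [h₂ m m le_rfl]
  have e₁ : ∑ k ∈ Finset.range (m + 1), (m.choose k : ℤ) * c m k =
      ∑ k ∈ Finset.range (m + 1), (m.choose k : ℤ) * c k k :=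
    Finset.sum_congr rfl fun k hk => by
      rw [huniq m k (Nat.lt_succ_iff.1 (Finset.mem_range.1 hk))]
  rw [e₁]
  -- Both sums extend to a common range: beyond `m` the binomial coefficient vanishes, beyond `K`
  -- the coefficient `c k k` does.
  have e₂ := Finset.sum_subset (f := fun k => (m.choose k : ℤ) * c k k)
    (Finset.range_mono (show m + 1 ≤ m + 1 + (K + 1) by omega)) (fun k _ hk => by
      rw [Finset.mem_range, not_lt] at hk
      rw [Nat.choose_eq_zero_of_lt (by omega), Nat.cast_zero, zero_mul])
  have e₃ := Finset.sum_subset (f := fun k => (m.choose k : ℤ) * c k k)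
    (Finset.range_mono (show K + 1 ≤ m + 1 + (K + 1) by omega)) (fun k _ hk => by
      rw [Finset.mem_range, not_lt] at hk
      rw [h₁ k k le_rfl (by omega), mul_zero])
  rw [e₂, e₃]

/-! ### Reflection lengths -/

section ReflectionLength

variable {α : Type*}

/-- The functions fixed by a permutation. -/
def fixedFunctions (σ : Perm α) : Submodule ℚ (α → ℚ) where
  carrier := {f | ∀ x, f (σ x) = f x}
  add_mem' hf hg x := by simp [hf x, hg x]
  zero_mem' _ := rfl
  smul_mem' c f hf x := by simp [hf x]

theorem mem_fixedFunctions {σ : Perm α} {f : α → ℚ} :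
    f ∈ fixedFunctions σ ↔ ∀ x, f (σ x) = f x := Iff.rfl

theorem fixedFunctions_mul (σ τ : Perm α) :
    fixedFunctions σ ⊓ fixedFunctions τ ≤ fixedFunctions (σ * τ) := by
  rintro f ⟨h₁, h₂⟩ x
  rw [Perm.mul_apply, h₁, h₂]

theorem apply_zpow_of_mem_fixedFunctions {σ : Perm α} {f : α → ℚ} (hf : f ∈ fixedFunctions σ)
    (k : ℤ) (x : α) : f ((σ ^ k) x) = f x := by
  rw [mem_fixedFunctions] at hf
  induction k using Int.induction_on with
  | zero => simp
  | succ k ih => rw [add_comm, zpow_add, Perm.mul_apply, zpow_one, hf, ih]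
  | pred k ih => rw [← hf, ← Perm.mul_apply, ← zpow_one_add, add_sub_cancel, ih]

variable [Fintype α]

/-- The codimension of the fixed space is the reflection length. It is subadditive because functions
fixed by both factors are fixed by the product. -/
theorem finrank_fixedFunctions_mul (σ τ : Perm α) :
    Module.finrank ℚ (fixedFunctions σ) + Module.finrank ℚ (fixedFunctions τ) ≤
      Fintype.card α + Module.finrank ℚ (fixedFunctions (σ * τ)) := by
  rw [← Submodule.finrank_sup_add_finrank_inf_eq, ← Module.finrank_fintype_fun_eq_card ℚ]
  exact add_le_add (Submodule.finrank_le _) (Submodule.finrank_mono (fixedFunctions_mul σ τ))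

variable [DecidableEq α]

/-- The map from points to cycles (including the cycles of length one). -/
def toCycles (σ : Perm α) (x : α) : σ.cycleFactorsFinset ⊕ {x // x ∉ σ.support} :=
  if h : x ∈ σ.support then .inl ⟨σ.cycleOf x, Perm.cycleOf_mem_cycleFactorsFinset_iff.2 h⟩
  else .inr ⟨x, h⟩

theorem toCycles_surjective (σ : Perm α) : Function.Surjective (toCycles σ) := by
  rintro (⟨c, hc⟩ | ⟨x, hx⟩)
  · obtain ⟨x, hx⟩ := (Perm.mem_cycleFactorsFinset_iff.1 hc).1.nonempty_support
    have hx' := Perm.mem_cycleFactorsFinset_support_le hc hx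
    refine ⟨x, ?_⟩
    rw [toCycles, dif_pos hx']
    congr 2
    exact (Perm.cycle_is_cycleOf hx hc).symm
  · exact ⟨x, by rw [toCycles, dif_neg hx]⟩

theorem toCycles_apply (σ : Perm α) (x : α) : toCycles σ (σ x) = toCycles σ x := by
  by_cases h : x ∈ σ.support
  · have h' : σ x ∈ σ.support := Perm.apply_mem_support.2 h
    rw [toCycles, toCycles, dif_pos h, dif_pos h']
    congr 2
    exact (Perm.SameCycle.refl σ x).apply_left.cycleOf_eq
  · rw [Perm.notMem_support.1 h]

theorem sameCycle_of_toCycles_eq {σ : Perm α} {x y : α} (h : toCycles σ x = toCycles σ y) :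
    σ.SameCycle x y := by
  simp only [toCycles] at h
  split_ifs at h with h₁ h₂ h₂
  · rw [Sum.inl.injEq, Subtype.mk.injEq] at h
    exact (Perm.sameCycle_iff_cycleOf_eq_of_mem_support h₁ h₂).2 h
  · rw [Sum.inr.injEq, Subtype.mk.injEq] at h
    rw [h]

theorem range_funLeft_toCycles (σ : Perm α) :
    LinearMap.range (LinearMap.funLeft ℚ ℚ (toCycles σ)) = fixedFunctions σ := by
  ext f
  rw [LinearMap.mem_range, mem_fixedFunctions]
  constructor
  · rintro ⟨v, rfl⟩ x
    simp [LinearMap.funLeft_apply, toCycles_apply]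
  · intro hf
    refine ⟨fun i => f (Function.surjInv (toCycles_surjective σ) i), ?_⟩
    ext x
    rw [LinearMap.funLeft_apply]
    obtain ⟨k, hk⟩ := sameCycle_of_toCycles_eq
      (Function.surjInv_eq (toCycles_surjective σ) (toCycles σ x))
    nth_rewrite 2 [← hk]
    exact (apply_zpow_of_mem_fixedFunctions hf k _).symm

/-- Fixed functions are the functions constant on cycles, so the dimension is the number of cycles,
fixed points included. -/
theorem finrank_fixedFunctions (σ : Perm α) :
    Module.finrank ℚ (fixedFunctions σ) + σ.cycleType.sum =
      Fintype.card α + Multiset.card σ.cycleType := by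
  rw [← range_funLeft_toCycles, LinearMap.finrank_range_of_inj
      (LinearMap.funLeft_injective_of_surjective _ _ _ (toCycles_surjective σ)),
    Module.finrank_fintype_fun_eq_card, Fintype.card_sum, Perm.sum_cycleType]
  have h₁ : Fintype.card {x // x ∉ σ.support} = Fintype.card α - σ.support.card := by
    rw [Fintype.card_subtype_compl, Fintype.card_coe]
  have h₂ := Finset.card_le_univ σ.support
  rw [h₁, Fintype.card_coe, Perm.cycleType_def, Multiset.card_map, Finset.card_val]
  omega

end ReflectionLength

theorem finrank_fixedFunctions_of_cycleType {n : ℕ} {σ : Perm (Fin n)} {la : EvenPartition}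
    (h : σ.cycleType = la.cyc) :
    Module.finrank ℚ (fixedFunctions σ) + la.size = n := by
  have h₁ := finrank_fixedFunctions σ
  have h₂ : Multiset.card la.cyc = la.length := by
    simp [EvenPartition.cyc, EvenPartition.length]
  rw [h, la.sum_cyc, h₂, Fintype.card_fin] at h₁
  omega

/-- By `finrank_fixedFunctions_of_cycleType` the reflection length of cycle type `λ` is `|λ|`.
Subadditivity then excludes that a product lies over the permutation of `t_ν`, so both terms of
`signedEq` vanish. -/
theorem structConst_eq_zero_of_size {n : ℕ} {la mu nu : EvenPartition}
    (h : la.size + mu.size < nu.size) : structConst n la mu nu = 0 := by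
  classical
  rcases Nat.lt_or_ge n (nu.size + nu.length) with hn | hn
  · exact (structConst_spec n la mu).1 nu hn
  rw [structConst_eq_sum hn]
  refine Finset.sum_eq_zero fun p hp => ?_
  obtain ⟨hp₁, hp₂⟩ := (Finset.mem_filter.1 hp).2
  have key : proj n (p.1 * p.2) ≠ proj n (tLift n nu) := by
    intro he
    have h₁ := finrank_fixedFunctions_of_cycleType (cycleType_of_mem_D hp₁)
    have h₂ := finrank_fixedFunctions_of_cycleType (cycleType_of_mem_D hp₂)
    have h₃ := finrank_fixedFunctions_of_cycleType (cycleType_tLift hn)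
    have h₄ := finrank_fixedFunctions_mul (proj n p.1) (proj n p.2)
    rw [← map_mul, he, Fintype.card_fin] at h₄
    omega
  rw [signedEq, if_neg, if_neg, sub_self]
  · intro e; rw [e] at key; simp at key
  · intro e; rw [e] at key; simp at key

/-! ### Structure polynomials -/

open Polynomial in
/-- The polynomial `binom(x - m, k)`. -/
def shiftedBinomial (m k : ℕ) : IntValued :=
  ⟨C ((k.factorial : ℚ)⁻¹) * (descPochhammer ℚ k).comp (X - C (m : ℚ)), fun r =>
    ⟨Ring.choose (r - m : ℤ) k, by
      -- The generalized binomial coefficient gives integrality also where `r - m` is negative.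
      have := Ring.descPochhammer_eq_factorial_smul_choose (r - m : ℤ) k
      rw [← Polynomial.eval_eq_smeval] at this
      have e : (r : ℚ) - (m : ℚ) = ((r - m : ℤ) : ℚ) := by push_cast; rfl
      rw [eval_mul, eval_C, eval_comp, eval_sub, eval_X, eval_C, e,
        ← descPochhammer_map (Int.castRingHom ℚ), Polynomial.eval_intCast_map, Int.cast_id, this]
      simp [Nat.factorial_ne_zero]⟩⟩

/-- Evaluation at an integer as a ring homomorphism. -/
def evalIntHom (k : ℤ) : IntValued →+* ℤ where
  toFun := evalInt k
  map_one' := by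
    have := evalInt_spec k 1
    simpa using this.symm
  map_zero' := by
    have := evalInt_spec k 0
    simpa using this.symm
  map_mul' p q := by
    have := evalInt_spec k (p * q)
    rw [Subring.coe_mul, Polynomial.eval_mul, evalInt_spec, evalInt_spec] at this
    exact_mod_cast this.symm
  map_add' p q := by
    have := evalInt_spec k (p + q)
    rw [Subring.coe_add, Polynomial.eval_add, evalInt_spec, evalInt_spec] at this
    exact_mod_cast this.symm

theorem evalIntHom_apply (k : ℤ) (p : IntValued) : evalIntHom k p = evalInt k p := rfl

theorem evalInt_shiftedBinomial (m k l : ℕ) :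
    evalInt ((m + l : ℕ) : ℤ) (shiftedBinomial m k) = l.choose k := by
  have h := evalInt_spec ((m + l : ℕ) : ℤ) (shiftedBinomial m k)
  have e : (((m + l : ℕ) : ℤ) : ℚ) - (m : ℚ) = (l : ℚ) := by push_cast; ring
  have h₁ := descPochhammer_eval_eq_descFactorial ℚ l k
  simp only [shiftedBinomial, Polynomial.eval_mul, Polynomial.eval_C, Polynomial.eval_comp,
    Polynomial.eval_sub, Polynomial.eval_X] at h
  rw [e, h₁, Nat.descFactorial_eq_factorial_mul_choose, Nat.cast_mul, ← mul_assoc,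
    inv_mul_cancel₀ (by exact_mod_cast k.factorial_ne_zero), one_mul] at h
  exact_mod_cast h.symm

theorem intValued_ext {p q : IntValued} (m : ℕ)
    (h : ∀ n : ℕ, m ≤ n → evalInt n p = evalInt n q) : p = q := by
  refine Subtype.ext (Polynomial.eq_of_infinite_eval_eq _ _ ?_)
  refine Set.Infinite.mono (s := (fun n : ℕ => ((n : ℤ) : ℚ)) '' Set.Ici m) ?_ ?_
  · rintro _ ⟨n, hn, rfl⟩
    change Polynomial.eval _ _ = Polynomial.eval _ _
    rw [evalInt_spec, evalInt_spec, h n hn]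
  · exact (Set.Ici_infinite m).image (fun a _ b _ hab => by simpa using hab)

theorem existsUnique_structurePolynomial (la mu nu : EvenPartition) :
    ∃! p : IntValued, IsStructurePolynomial la mu nu p := by
  obtain ⟨K, c, hc⟩ := exists_binomial_coeffs_all la mu nu
  refine ⟨∑ k ∈ Finset.range (K + 1),
    c k • shiftedBinomial (nu.size + nu.length) k, fun n hn => ?_, fun p hp => ?_⟩
  · obtain ⟨m, rfl⟩ := Nat.exists_eq_add_of_le hn
    rw [hc, ← evalIntHom_apply, map_sum]
    refine Finset.sum_congr rfl fun k _ => ?_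
    rw [map_zsmul, evalIntHom_apply, evalInt_shiftedBinomial, smul_eq_mul, mul_comm]
  · refine intValued_ext (nu.size + nu.length) fun n hn => ?_
    obtain ⟨m, rfl⟩ := Nat.exists_eq_add_of_le hn
    rw [hp _ hn, hc, ← evalIntHom_apply, map_sum]
    refine Finset.sum_congr rfl fun k _ => ?_
    rw [map_zsmul, evalIntHom_apply, evalInt_shiftedBinomial, smul_eq_mul, mul_comm]

theorem structPoly_spec (la mu nu : EvenPartition) :
    IsStructurePolynomial la mu nu (structPoly la mu nu) :=
  Classical.epsilon_spec (existsUnique_structurePolynomial la mu nu).exists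

/-! ### The specializations of the spin FH-algebra -/

/-- The specialization `∑ f_λ d_λ ↦ ∑ f_λ(n) d_λ(n)`. -/
def specialize (n : ℕ) : SpinFH →+ SpinAlg n where
  toFun a := (SpinFH.d.repr a).sum fun la p => evalInt n p • dn n la
  map_zero' := by simp
  map_add' a b := by
    rw [map_add]
    refine Finsupp.sum_add_index' (fun la => ?_) fun la p q => ?_
    · rw [← evalIntHom_apply, map_zero, zero_smul]
    · simp only [← evalIntHom_apply, map_add, add_smul]

theorem specialize_apply (n : ℕ) (a : SpinFH) :
    specialize n a = (SpinFH.d.repr a).sum fun la p => evalInt n p • dn n la := rfl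

theorem specialize_smul (n : ℕ) (p : IntValued) (a : SpinFH) :
    specialize n (p • a) = evalInt n p • specialize n a := by
  rw [specialize_apply, specialize_apply, map_smul, Finsupp.sum_smul_index', Finsupp.smul_sum]
  · refine Finsupp.sum_congr fun la _ => ?_
    simp only [← evalIntHom_apply, smul_eq_mul, map_mul, mul_smul]
  · intro la
    rw [← evalIntHom_apply, map_zero, zero_smul]

theorem specialize_d (n : ℕ) (la : EvenPartition) : specialize n (SpinFH.d la) = dn n la := by
  rw [specialize_apply, Module.Basis.repr_self, Finsupp.sum_single_index]
  · rw [← evalIntHom_apply, map_one, one_smul]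
  · rw [← evalIntHom_apply, map_zero, zero_smul]

/-- The two sums have different ranges. Terms with `ν` too large for `n` vanish since `d_ν(n) = 0`,
whatever the value of the polynomial there. Terms with `|ν| > |λ| + |μ|` vanish by reflection
length. -/
theorem specialize_d_mul_d (n : ℕ) (la mu : EvenPartition) :
    specialize n (SpinFH.d la * SpinFH.d mu) = dn n la * dn n mu := by
  rw [SpinFH.d_mul_d, map_sum, (structConst_spec n la mu).2]
  have key : ∀ nu, specialize n (structPoly la mu nu • SpinFH.d nu) =
      structConst n la mu nu • dn n nu := by
    intro nu
    rw [specialize_smul, specialize_d]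
    rcases Nat.lt_or_ge n (nu.size + nu.length) with h | h
    · rw [dn_eq_zero h, smul_zero, smul_zero]
    · rw [structPoly_spec la mu nu n h]
  simp only [key]
  trans ∑ nu ∈ EvenPartition.sizeLE (la.size + mu.size) ∩ EvenPartition.fits n,
    structConst n la mu nu • dn n nu
  · refine (Finset.sum_subset Finset.inter_subset_left fun nu h₁ h₂ => ?_).symm
    rw [Finset.mem_inter, not_and, EvenPartition.mem_fits] at h₂
    rw [dn_eq_zero (not_le.1 (h₂ h₁)), smul_zero]
  · refine Finset.sum_subset Finset.inter_subset_right fun nu h₁ h₂ => ?_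
    rw [Finset.mem_inter, not_and', EvenPartition.mem_sizeLE] at h₂
    rw [structConst_eq_zero_of_size (not_le.1 (h₂ h₁)), zero_smul]

theorem spinFH_induction {p : SpinFH → Prop} (hd : ∀ la, p (SpinFH.d la))
    (hadd : ∀ a b, p a → p b → p (a + b)) (hsmul : ∀ (c : IntValued) a, p a → p (c • a))
    (a : SpinFH) : p a := by
  have h0 : p 0 := by
    rw [← zero_smul IntValued (SpinFH.d EvenPartition.empty)]
    exact hsmul _ _ (hd _)
  have ha : a ∈ Submodule.span IntValued (Set.range SpinFH.d) := by
    rw [SpinFH.d.span_eq]; trivial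
  induction ha using Submodule.span_induction with
  | mem x hx => obtain ⟨la, rfl⟩ := hx; exact hd la
  | zero => exact h0
  | add x y _ _ hx hy => exact hadd x y hx hy
  | smul c x _ hx => exact hsmul c x hx

theorem specialize_mul (n : ℕ) (a b : SpinFH) :
    specialize n (a * b) = specialize n a * specialize n b := by
  induction a using spinFH_induction with
  | hd la =>
    induction b using spinFH_induction with
    | hd mu => rw [specialize_d_mul_d, specialize_d, specialize_d]
    | hadd a b ha hb => rw [mul_add, map_add, map_add, ha, hb, mul_add]
    | hsmul c a ha => rw [mul_smul_comm, specialize_smul, specialize_smul, ha, mul_smul_comm]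
  | hadd x y hx hy => rw [add_mul, map_add, map_add, hx, hy, add_mul]
  | hsmul c x hx => rw [smul_mul_assoc, specialize_smul, specialize_smul, hx, smul_mul_assoc]

theorem specialize_mem (n : ℕ) (a : SpinFH) : specialize n a ∈ evenCenter n := by
  rw [specialize_apply]
  exact Subalgebra.sum_mem _ fun la _ => Subalgebra.smul_mem _ (dn_mem_evenCenter la) _

theorem spinCoef_specialize {n : ℕ} {la : EvenPartition} (h : la.size + la.length ≤ n)
    (a : SpinFH) : spinCoef n (tLift n la) (specialize n a) = evalInt n (SpinFH.d.repr a la) := by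
  induction a using spinFH_induction with
  | hd mu =>
    rw [specialize_d, spinCoef_tLift_dn h, Module.Basis.repr_self, Finsupp.single_apply,
      ← evalIntHom_apply]
    split_ifs <;> simp
  | hadd a b ha hb =>
    rw [map_add, map_add, ha, hb, map_add, Finsupp.add_apply]
    simp only [← evalIntHom_apply, map_add]
  | hsmul c a ha =>
    rw [specialize_smul, map_zsmul, ha, map_smul, Finsupp.smul_apply]
    simp only [← evalIntHom_apply, smul_eq_mul, map_mul]

/-- The coefficient of `d_λ` can be read off at every `n ≥ |λ| + ℓ(λ)`, and these infinitely many
values determine a polynomial. -/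
theorem specialize_ext {a b : SpinFH} (h : ∀ n, specialize n a = specialize n b) : a = b := by
  refine SpinFH.d.repr.injective (Finsupp.ext fun la => ?_)
  refine intValued_ext (la.size + la.length) fun n hn => ?_
  rw [← spinCoef_specialize hn, ← spinCoef_specialize hn, h n]

theorem dn_empty (n : ℕ) : dn n EvenPartition.empty = 1 := by
  classical
  have h : EvenPartition.empty.size + EvenPartition.empty.length ≤ n := by
    simp [EvenPartition.empty, EvenPartition.size, EvenPartition.length]
  have ht : tLift n EvenPartition.empty = 1 := by
    apply incl_injective
    rw [incl_tLift h, map_one, tPart]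
    have : EvenPartition.empty.parts = [] := by
      rw [← Multiset.coe_eq_zero, EvenPartition.coe_parts]
      rfl
    rw [this, blockCycles]
  rw [dn_eq_sum, Finset.sum_eq_single 1]
  · simp
  · intro g hg hne
    have := (mem_D.1 (Finset.mem_filter.1 hg).2).2
    rw [ht, isConj_one_right] at this
    exact absurd this hne
  · intro h'
    refine absurd (Finset.mem_filter.2 ⟨Finset.mem_univ _, ?_⟩) h'
    rw [← ht]
    exact tLift_mem_D h

theorem specialize_surjective (n : ℕ) {x : SpinAlg n} (hx : x ∈ evenCenter n) :
    ∃ a, specialize n a = x := by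
  -- Constant polynomials suffice for a preimage, since the class sums span the even center over
  -- `ℤ`.
  refine ⟨∑ nu ∈ EvenPartition.fits n,
    ((spinCoef n (tLift n nu) x : ℤ) : IntValued) • SpinFH.d nu, ?_⟩
  rw [map_sum]
  nth_rewrite 2 [evenCenter_eq_sum hx]
  refine Finset.sum_congr rfl fun nu _ => ?_
  rw [specialize_smul, specialize_d, ← evalIntHom_apply, map_intCast, Int.cast_id]

end SpinSym

end

theorem mainTheorem6 :
    -- the structure constants `a_{λμ}^ν(n)` are well defined
    (∀ (n : ℕ) (la mu : SpinSym.EvenPartition),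
      ∃! a : SpinSym.EvenPartition → ℤ, SpinSym.IsStructureConstants n la mu a) ∧
    -- the integer-valued polynomials `f_{λμ}^ν` are well defined
    (∀ la mu nu : SpinSym.EvenPartition,
      ∃! p : SpinSym.IntValued, SpinSym.IsStructurePolynomial la mu nu p) ∧
    -- `𝒦` is associative, commutative, and has the unit `d_∅`
    (∀ a b c : SpinSym.SpinFH, a * b * c = a * (b * c)) ∧
    (∀ a b : SpinSym.SpinFH, a * b = b * a) ∧
    (∀ a : SpinSym.SpinFH, SpinSym.SpinFH.d SpinSym.EvenPartition.empty * a = a) ∧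
    -- the surjective homomorphisms `φ_n`
    (∀ n : ℕ, ∃ φ : SpinSym.SpinFH →ₙ+* SpinSym.evenCenter n,
      Function.Surjective φ ∧
      φ (SpinSym.SpinFH.d SpinSym.EvenPartition.empty) = 1 ∧
      ∀ a : SpinSym.SpinFH, (φ a : SpinSym.SpinAlg n) =
        (SpinSym.SpinFH.d.repr a).sum fun la p => SpinSym.evalInt n p • SpinSym.dn n la) := by
  refine ⟨SpinSym.existsUnique_structureConstants, SpinSym.existsUnique_structurePolynomial,
    fun a b c => SpinSym.specialize_ext fun n => ?_, fun a b => SpinSym.specialize_ext fun n => ?_,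
    fun a => SpinSym.specialize_ext fun n => ?_, fun n => ?_⟩
  · simp only [SpinSym.specialize_mul, mul_assoc]
  · rw [SpinSym.specialize_mul, SpinSym.specialize_mul]
    -- Every specialization takes values in the center, so commutativity holds after specialization.
    exact Subalgebra.mem_center_iff.1 (SpinSym.specialize_mem n b).1 _
  · rw [SpinSym.specialize_mul, SpinSym.specialize_d, SpinSym.dn_empty, one_mul]
  · refine ⟨{ toFun := fun a => ⟨SpinSym.specialize n a, SpinSym.specialize_mem n a⟩
              map_mul' := fun a b => Subtype.ext (SpinSym.specialize_mul n a b)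
              map_zero' := Subtype.ext (map_zero (SpinSym.specialize n))
              map_add' := fun a b => Subtype.ext (map_add (SpinSym.specialize n) a b) },
      fun x => ?_, Subtype.ext ?_, fun a => rfl⟩
    · obtain ⟨a, ha⟩ := SpinSym.specialize_surjective n x.2
      exact ⟨a, Subtype.ext ha⟩
    · exact (SpinSym.specialize_d n _).trans (SpinSym.dn_empty n)
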